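/- Let $d\in\mathbb N$ and $\gamma\in(-d,0)$. Let $b:[-1,1]\to[0,\infty)$ be an even measurable function such that $\sigma\mapsto b(e\cdot\sigma)$ belongs to $L^\infty(\mathbb S^{d-1})$ and $\|b\|_1=\int_{\mathbb S^{d-1}}b(e\cdot\sigma)\,d\sigma=1$ for unit vectors $e\in\mathbb R^d$ (by rotation invariance, the choice of $e$ is immaterial). Let $\mathcal M(v)=(2\pi)^{-d/2}e^{-|v|^2/2}$ and let $$\boldsymbol L_\gamma f(v)=\int_{\mathbb R^d\times\mathbb S^{d-1}}|v-v_*|^\gamma\, b\Big(\tfrac{v-v_*}{|v-v_*|}\cdot\sigma\Big)\big(f(v')\mathcal M(v_*')-f(v)\mathcal M(v_*)\big)\,dv_*\,d\sigma,$$ $$v'=\tfrac{v+v_*}2+\tfrac{|v-v_*|}2\sigma,\qquad v_*'=\tfrac{v+v_*}2-\tfrac{|v-v_*|}2\sigma,$$ be the linear Boltzmann operator. Let $s=2$ or $s>2\max(|\gamma|,1)$, and let $f_0\ge 0$ be measurable with $\int_{\mathbb R^d} f_0(v)\,dv=1$ and $$\|f_0\|_{L^1_s}=\int_{\mathbb R^d}(1+|v|^2)^{s/2}|f_0(v)|\,dv<\infty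 .$$ Let $f\in C([0,\infty);L^1(\mathbb R^d))$ be the mild solution of $\partial_t f=\boldsymbol L_\gamma f$, $f(0)=f_0$, that is, $f(t)=f_0+\boldsymbol L_\gamma\int_0^t f(\tau)\,d\tau$ for all $t\ge0$. Then there is a constant $C_s$, depending only on $s$, $\gamma$, $d$, $b$ and $\|f_0\|_{L^1_s}$, such that for all $t\ge 0$ the moment $m_s(t)=\int_{\mathbb R^d}|v|^s f(t,v)\,dv$ is finite (the integrand is integrable) and $$m_s(t)\le C_s(1+t).$$ -/

import Mathlib

open MeasureTheory Set

noncomputable section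

namespace LinearBoltzmann

/-- Velocity space `ℝ^d` with its Euclidean norm. -/
abbrev Vel (d : ℕ) : Type := EuclideanSpace ℝ (Fin d)

/-- The unit sphere `S^{d-1}`. -/
abbrev Sph (d : ℕ) : Type := Metric.sphere (0 : Vel d) 1

/-- The (unnormalised) surface measure on `S^{d-1}`. -/
def surf (d : ℕ) : Measure (Sph d) := (volume : Measure (Vel d)).toSphere

/-- The normalised Maxwellian `(2π)^{-d/2} exp (-|v|²/2)`. -/
def maxwellian {d : ℕ} (v : Vel d) : ℝ :=
  1 / (2 * Real.pi) ^ ((d : ℝ) / 2) * Real.exp (-‖v‖ ^ 2 / 2)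

/-- The pre-collisional velocity `v'`. -/
def vPre {d : ℕ} (v w : Vel d) (σ : Sph d) : Vel d :=
  (1 / 2 : ℝ) • (v + w) + (‖v - w‖ / 2) • (σ : Vel d)

/-- The pre-collisional velocity `v_*'`. -/
def wPre {d : ℕ} (v w : Vel d) (σ : Sph d) : Vel d :=
  (1 / 2 : ℝ) • (v + w) - (‖v - w‖ / 2) • (σ : Vel d)

/-- `cos θ = (v - v_*) / |v - v_*| · σ`. -/
def cosDev {d : ℕ} (v w : Vel d) (σ : Sph d) : ℝ :=
  inner ℝ (‖v - w‖⁻¹ • (v - w)) (σ : Vel d)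

/-- The collision kernel `|v - v_*|^γ b(cos θ)`. -/
def kernelB {d : ℕ} (γ : ℝ) (b : ℝ → ℝ) (v w : Vel d) (σ : Sph d) : ℝ :=
  ‖v - w‖ ^ γ * b (cosDev v w σ)

/-- The bilinear collision operator `Q_γ(f, g)`, as an integral over `(v_*, σ) ∈ ℝ^d × S^{d-1}`. -/
def collisionQ {d : ℕ} (γ : ℝ) (b : ℝ → ℝ) (f g : Vel d → ℝ) (v : Vel d) : ℝ :=
  ∫ p : Vel d × Sph d,
    kernelB γ b v p.1 p.2 * (f (vPre v p.1 p.2) * g (wPre v p.1 p.2) - f v * g p.1)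
    ∂((volume : Measure (Vel d)).prod (surf d))

/-- The linear Boltzmann operator `L_γ f = Q_γ(f, M)`. -/
def opL {d : ℕ} (γ : ℝ) (b : ℝ → ℝ) (f : Vel d → ℝ) : Vel d → ℝ :=
  collisionQ γ b f maxwellian

/-- Angular kernels: even nonnegative (Borel) functions `b` on `[-1,1]`, normalised by
`‖b‖₁ = ∫_{S^{d-1}} b(cos θ) dσ = 1` and essentially bounded on the sphere. By rotation invariance
of the surface measure the two last conditions do not depend on the axis `e`. -/
structure IsBoundedAngularKernel (d : ℕ) (b : ℝ → ℝ) : Prop where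
  measurable : Measurable b
  nonneg : ∀ x ∈ Icc (-1 : ℝ) 1, 0 ≤ b x
  even : ∀ x ∈ Icc (-1 : ℝ) 1, b (-x) = b x
  norm_one : ∀ e : Vel d, ‖e‖ = 1 → ∫ σ : Sph d, b (inner ℝ e (σ : Vel d)) ∂(surf d) = 1
  bounded : ∃ B : ℝ, ∀ e : Vel d, ‖e‖ = 1 →
    ∀ᵐ σ : Sph d ∂(surf d), b (inner ℝ e (σ : Vel d)) ≤ B

/-- `⟨v⟩ = √(1 + |v|²)`. -/
def bracket {d : ℕ} (v : Vel d) : ℝ := Real.sqrt (1 + ‖v‖ ^ 2)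

/-- Membership in the weighted space `L¹_s(ℝ^d)`. -/
def MemWeightedL1 {d : ℕ} (s : ℝ) (f : Vel d → ℝ) : Prop :=
  AEStronglyMeasurable f volume ∧ Integrable (fun v => bracket v ^ s * |f v|) volume

/-- The norm `‖f‖_{L¹_s} = ∫ ⟨v⟩^s |f(v)| dv`. -/
def weightedL1Norm {d : ℕ} (s : ℝ) (f : Vel d → ℝ) : ℝ :=
  ∫ v, bracket v ^ s * |f v|

/-- The moment `m_k(f) = ∫ |v|^k f(v) dv`. -/
def moment {d : ℕ} (k : ℝ) (f : Vel d → ℝ) : ℝ :=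
  ∫ v, ‖v‖ ^ k * f v

/-- Mild solutions on `[0, ∞)` of `∂ₜ f = L_γ f`, `f(0) = f₀`: continuous curves in `L¹(ℝ^d)` with
`f(t) = f₀ + L_γ (∫₀ᵗ f(τ) dτ)` for all `t ≥ 0`, the integral being taken in `L¹(ℝ^d)`. -/
structure IsMildSolution {d : ℕ} (γ : ℝ) (b : ℝ → ℝ) (f₀ : Vel d → ℝ)
    (f : ℝ → (Vel d →₁[volume] ℝ)) : Prop where
  continuousOn : ContinuousOn f (Ici 0)
  mild : ∀ t : ℝ, 0 ≤ t → ∀ᵐ v : Vel d,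
    f t v = f₀ v + opL γ b (∫ τ in (0 : ℝ)..t, f τ : Vel d →₁[volume] ℝ) v

end LinearBoltzmann

end

noncomputable section

namespace LinearBoltzmann

variable {d : ℕ}

/-! The collision frequency `ν` is bounded by a constant `K`, because `γ > -d` makes `|z|^γ` locally
integrable. In `A = L_γ + K` the loss becomes multiplication by `K - ν ≥ 0`, so `|A h| ≤ gain |h| +
(K - ν) |h|` almost everywhere (`enorm_opL_add_le`).

The collision is a measure-preserving involution, which moves a weight `W` in `∫ W · gain g` onto
`W(v')` (`lintegral_gain`). With `W = 1` the gain cancels `ν` and `A` multiplies the `L¹` norm by at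
most `K`. With `W = |v|^s`, convexity gives `|v'|^s ≤ (1 + cos θ) |v|^s + C |v_*|^s`
(`exists_norm_vPre_rpow_le`). Since `b` is even with mass one, `b (1 + cos θ)` also has mass one.
The top-order terms of gain and loss thus cancel exactly, and `A` multiplies the weighted norm by at
most `K`, up to `M ‖h‖₁`.

Since `L_γ` is bounded on `L¹`, the mild solution is `e^{-Kt} e^{tA} f₀` (`eq_exp_of_mild`).
Iteration bounds the weighted norm of `A^n f₀` by `K^n N + n K^(n-1) M`, where `N = ‖f₀‖_{L¹_s}`.
Summing the exponential series gives `m_s(t) ≤ N + M t` (`lintegral_mul_enorm_exp_le`). -/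

instance : IsFiniteMeasure (surf d) := by
  unfold surf
  infer_instance

/-! ### Polar coordinates and the collision involution. -/

/-- The direction `z / |z|` of a vector, with a prescribed value at the origin. -/
def direction (z : Vel d) (σ : Sph d) : Sph d :=
  if h : z = 0 then σ else ⟨‖z‖⁻¹ • z, by simp [norm_smul, h]⟩

lemma coe_direction (z : Vel d) (σ : Sph d) :
    (direction z σ : Vel d) = if z = 0 then (σ : Vel d) else ‖z‖⁻¹ • z := by
  unfold direction
  split_ifs <;> rfl

lemma measurable_direction : Measurable fun q : Vel d × Sph d => direction q.1 q.2 := by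
  refine (MeasurableEmbedding.subtype_coe Metric.isClosed_sphere.measurableSet).measurable_comp_iff.1
    ?_
  have : ((fun x : Sph d => (x : Vel d)) ∘ fun q : Vel d × Sph d => direction q.1 q.2) =
      fun q => if q.1 = 0 then (q.2 : Vel d) else ‖q.1‖⁻¹ • q.1 := by
    funext q
    exact coe_direction q.1 q.2
  rw [this]
  refine Measurable.ite (measurable_fst (measurableSet_singleton 0)) (by fun_prop) (by fun_prop)

lemma norm_coe_sph (σ : Sph d) : ‖(σ : Vel d)‖ = 1 := by
  simp

lemma norm_smul_direction (z : Vel d) (σ : Sph d) : ‖z‖ • (direction z σ : Vel d) = z := by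
  rw [coe_direction]
  split_ifs with h
  · simp [h]
  · rw [smul_smul, mul_inv_cancel₀ (by simpa using h), one_smul]

lemma direction_smul {r : ℝ} (hr : 0 < r) (τ σ : Sph d) : direction (r • (τ : Vel d)) σ = τ := by
  apply Subtype.ext
  rw [coe_direction]
  have h1 := norm_coe_sph τ
  have h0 : (τ : Vel d) ≠ 0 := by
    intro h
    simp [h] at h1
  rw [if_neg (by simp [hr.ne', h0]), norm_smul, h1, smul_smul]
  simp [abs_of_pos hr, hr.ne']

lemma lintegral_polar [Nontrivial (Vel d)] (H : Vel d → ENNReal) (hH : Measurable H) :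
    ∫⁻ z, H z = ∫⁻ σ : Sph d, ∫⁻ r : Ioi (0 : ℝ), H ((r : ℝ) • (σ : Vel d))
      ∂(Measure.volumeIoiPow (Module.finrank ℝ (Vel d) - 1)) ∂(surf d) := by
  have hmp := (volume : Measure (Vel d)).measurePreserving_homeomorphUnitSphereProd
  have hG : Measurable fun p : Sph d × Ioi (0 : ℝ) => H ((p.2 : ℝ) • (p.1 : Vel d)) := by fun_prop
  have h := hmp.lintegral_comp hG
  unfold surf
  have h0 : ∫⁻ z, H z = ∫⁻ z in ({0}ᶜ : Set (Vel d)), H z := by rw [restrict_compl_singleton]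
  rw [← lintegral_prod _ hG.aemeasurable, ← h, h0,
    ← lintegral_subtype_comap (measurableSet_singleton _).compl]
  refine lintegral_congr fun z => ?_
  have hz : ‖(z : Vel d)‖ ≠ 0 := norm_ne_zero_iff.2 z.2
  simp [smul_smul, hz]

/-- Exchanging the direction of `z` with `σ` preserves the measure `dz dσ`. -/
lemma lintegral_exchange_direction [Nontrivial (Vel d)] (F : Vel d × Sph d → ENNReal)
    (hF : Measurable F) :
    ∫⁻ q : Vel d × Sph d, F (‖q.1‖ • (q.2 : Vel d), direction q.1 q.2)
        ∂((volume : Measure (Vel d)).prod (surf d)) =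
      ∫⁻ q, F q ∂((volume : Measure (Vel d)).prod (surf d)) := by
  have hm : Measurable fun q : Vel d × Sph d =>
      F (‖q.1‖ • (q.2 : Vel d), direction q.1 q.2) :=
    hF.comp (Measurable.prodMk (by fun_prop) measurable_direction)
  rw [lintegral_prod _ hm.aemeasurable, lintegral_prod _ hF.aemeasurable,
    lintegral_polar _ hm.lintegral_prod_right', lintegral_polar _ hF.lintegral_prod_right']
  -- For `z = r τ` the substitution keeps `r` and swaps `τ` with `σ`, so Tonelli's theorem suffices.
  have h1 : ∀ (τ σ : Sph d) (r : Ioi (0 : ℝ)),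
      F (‖(r : ℝ) • (τ : Vel d)‖ • (σ : Vel d), direction ((r : ℝ) • (τ : Vel d)) σ) =
        F ((r : ℝ) • (σ : Vel d), τ) := by
    intro τ σ r
    have hr : (0 : ℝ) < r := r.2
    rw [direction_smul hr, norm_smul, norm_coe_sph, Real.norm_of_nonneg hr.le, mul_one]
  simp only [h1]
  have h2 : ∀ τ : Sph d, ∫⁻ r : Ioi (0 : ℝ), ∫⁻ σ : Sph d, F ((r : ℝ) • (σ : Vel d), τ) ∂(surf d)
      ∂(Measure.volumeIoiPow (Module.finrank ℝ (Vel d) - 1)) =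
      ∫⁻ σ : Sph d, ∫⁻ r : Ioi (0 : ℝ), F ((r : ℝ) • (σ : Vel d), τ)
      ∂(Measure.volumeIoiPow (Module.finrank ℝ (Vel d) - 1)) ∂(surf d) := by
    intro τ
    rw [lintegral_lintegral_swap]
    exact (hF.comp (by fun_prop : Measurable fun p : Ioi (0 : ℝ) × Sph d =>
      ((p.1 : ℝ) • (p.2 : Vel d), τ))).aemeasurable
  have h3 : ∀ σ : Sph d, ∫⁻ r : Ioi (0 : ℝ), ∫⁻ τ : Sph d, F ((r : ℝ) • (σ : Vel d), τ) ∂(surf d)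
      ∂(Measure.volumeIoiPow (Module.finrank ℝ (Vel d) - 1)) =
      ∫⁻ τ : Sph d, ∫⁻ r : Ioi (0 : ℝ), F ((r : ℝ) • (σ : Vel d), τ)
      ∂(Measure.volumeIoiPow (Module.finrank ℝ (Vel d) - 1)) ∂(surf d) := by
    intro σ
    rw [lintegral_lintegral_swap]
    exact (hF.comp (by fun_prop : Measurable fun p : Ioi (0 : ℝ) × Sph d =>
      ((p.1 : ℝ) • (σ : Vel d), p.2))).aemeasurable
  simp only [h2, h3]
  rw [lintegral_lintegral_swap]
  have : Measurable fun x : (Sph d × Sph d) × Ioi (0 : ℝ) =>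
      F ((x.2 : ℝ) • (x.1.2 : Vel d), x.1.1) :=
    hF.comp (by fun_prop : Measurable fun x : (Sph d × Sph d) × Ioi (0 : ℝ) =>
      ((x.2 : ℝ) • (x.1.2 : Vel d), x.1.1))
  exact this.lintegral_prod_right'.aemeasurable

/-- The measure `dv dv_* dσ`. -/
def collisionMeasure (d : ℕ) : Measure (Vel d × Vel d × Sph d) :=
  (volume : Measure (Vel d)).prod ((volume : Measure (Vel d)).prod (surf d))

/-- The collision involution `(v, v_*, σ) ↦ (v', v_*', (v - v_*) / |v - v_*|)`. -/
def collide (p : Vel d × Vel d × Sph d) : Vel d × Vel d × Sph d :=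
  (vPre p.1 p.2.1 p.2.2, wPre p.1 p.2.1 p.2.2, direction (p.1 - p.2.1) p.2.2)

lemma collide_fst (p : Vel d × Vel d × Sph d) : (collide p).1 = vPre p.1 p.2.1 p.2.2 := rfl

lemma collide_snd_fst (p : Vel d × Vel d × Sph d) :
    (collide p).2.1 = wPre p.1 p.2.1 p.2.2 := rfl

lemma measurable_collide : Measurable (collide (d := d)) := by
  unfold collide vPre wPre
  refine Measurable.prodMk (by fun_prop) (Measurable.prodMk (by fun_prop) ?_)
  exact measurable_direction.comp (by fun_prop : Measurable fun p : Vel d × Vel d × Sph d =>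
    (p.1 - p.2.1, p.2.2))

/-- In the variables `z = v - v_*`, `v_*`, `σ`, a collision is an exchange of the direction of `z`
with `σ`, followed by a translation of `v_*`. -/
lemma lintegral_collisionMeasure (F : Vel d × Vel d × Sph d → ENNReal) (hF : Measurable F) :
    ∫⁻ p, F p ∂(collisionMeasure d) =
      ∫⁻ q : Vel d × Sph d, ∫⁻ w : Vel d, F (w + q.1, w, q.2) ∂volume
        ∂((volume : Measure (Vel d)).prod (surf d)) := by
  have hm : Measurable fun x : (Vel d × Sph d) × Vel d => F (x.2 + x.1.1, x.2, x.1.2) :=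
    hF.comp (by fun_prop)
  have hm2 : Measurable fun x : Vel d × Vel d × Sph d => F (x.2.1 + x.1, x.2.1, x.2.2) :=
    hF.comp (by fun_prop)
  rw [collisionMeasure, lintegral_prod_symm' _ hF]
  calc ∫⁻ q : Vel d × Sph d, ∫⁻ v : Vel d, F (v, q) ∂volume
        ∂((volume : Measure (Vel d)).prod (surf d))
      = ∫⁻ q : Vel d × Sph d, ∫⁻ z : Vel d, F (q.1 + z, q.1, q.2) ∂volume
        ∂((volume : Measure (Vel d)).prod (surf d)) := by
        refine lintegral_congr fun q => ?_
        exact (lintegral_add_left_eq_self (fun v => F (v, q)) q.1).symm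
    _ = ∫⁻ w : Vel d, ∫⁻ σ, ∫⁻ z : Vel d, F (w + z, w, σ) ∂volume ∂(surf d) :=
        lintegral_prod _ hm2.lintegral_prod_left'.aemeasurable
    _ = ∫⁻ w : Vel d, ∫⁻ z : Vel d, ∫⁻ σ, F (w + z, w, σ) ∂(surf d) := by
        refine lintegral_congr fun w => ?_
        refine lintegral_lintegral_swap ?_
        exact (hF.comp (by fun_prop : Measurable fun p : Sph d × Vel d =>
          (w + p.2, w, p.1))).aemeasurable
    _ = ∫⁻ z : Vel d, ∫⁻ w : Vel d, ∫⁻ σ, F (w + z, w, σ) ∂(surf d) := by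
        refine lintegral_lintegral_swap ?_
        have : Measurable fun x : (Vel d × Vel d) × Sph d => F (x.1.1 + x.1.2, x.1.1, x.2) :=
          hF.comp (by fun_prop)
        exact this.lintegral_prod_right'.aemeasurable
    _ = ∫⁻ z : Vel d, ∫⁻ σ, ∫⁻ w : Vel d, F (w + z, w, σ) ∂volume ∂(surf d) := by
        refine lintegral_congr fun z => ?_
        refine lintegral_lintegral_swap ?_
        exact (hF.comp (by fun_prop : Measurable fun p : Vel d × Sph d =>
          (p.1 + z, p.1, p.2))).aemeasurable
    _ = _ := (lintegral_prod _ hm.lintegral_prod_right'.aemeasurable).symm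

lemma lintegral_comp_collide [Nontrivial (Vel d)] (F : Vel d × Vel d × Sph d → ENNReal)
    (hF : Measurable F) :
    ∫⁻ p, F (collide p) ∂(collisionMeasure d) = ∫⁻ p, F p ∂(collisionMeasure d) := by
  have hm : Measurable fun x : (Vel d × Sph d) × Vel d => F (x.2 + x.1.1, x.2, x.1.2) :=
    hF.comp (by fun_prop)
  rw [lintegral_collisionMeasure (fun p => F (collide p)) (hF.comp measurable_collide),
    lintegral_collisionMeasure _ hF,
    ← lintegral_exchange_direction (fun q => ∫⁻ w : Vel d, F (w + q.1, w, q.2))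
      hm.lintegral_prod_right']
  refine lintegral_congr fun q => ?_
  -- The translation is `v_*' - v_* = (z - |z| σ) / 2`, which does not depend on `v_*`.
  rw [← lintegral_add_right_eq_self (fun w => F (w + ‖q.1‖ • (q.2 : Vel d), w, direction q.1 q.2))
    ((1 / 2 : ℝ) • q.1 - (‖q.1‖ / 2) • (q.2 : Vel d))]
  refine lintegral_congr fun w => ?_
  congr 1
  simp only [collide, vPre, wPre, add_sub_cancel_left, Prod.mk.injEq, and_true]
  constructor <;> module

lemma measurePreserving_collide [Nontrivial (Vel d)] :
    MeasurePreserving (collide (d := d)) (collisionMeasure d) (collisionMeasure d) := by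
  refine ⟨measurable_collide, Measure.ext_of_lintegral _ fun F hF => ?_⟩
  rw [lintegral_map hF measurable_collide, lintegral_comp_collide F hF]

lemma vPre_sub_wPre (v w : Vel d) (σ : Sph d) :
    vPre v w σ - wPre v w σ = ‖v - w‖ • (σ : Vel d) := by
  unfold vPre wPre
  module

lemma norm_vPre_sub_wPre (v w : Vel d) (σ : Sph d) : ‖vPre v w σ - wPre v w σ‖ = ‖v - w‖ := by
  rw [vPre_sub_wPre, norm_smul, norm_coe_sph, mul_one, norm_norm]

/-- The value `σ` of `direction` at the origin makes this exact on the diagonal `v = v_*` too. -/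
lemma collide_collide (p : Vel d × Vel d × Sph d) : collide (collide p) = p := by
  obtain ⟨v, w, σ⟩ := p
  have hd := norm_smul_direction (v - w) σ
  unfold collide
  simp only [Prod.mk.injEq]
  refine ⟨?_, ?_, ?_⟩
  · rw [vPre, norm_vPre_sub_wPre]
    have : (‖v - w‖ / 2) • (direction (v - w) σ : Vel d) = (1 / 2 : ℝ) • (v - w) := by
      conv_rhs => rw [← hd]
      module
    rw [this]
    unfold vPre wPre
    module
  · rw [wPre, norm_vPre_sub_wPre]
    have : (‖v - w‖ / 2) • (direction (v - w) σ : Vel d) = (1 / 2 : ℝ) • (v - w) := by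
      conv_rhs => rw [← hd]
      module
    rw [this]
    unfold vPre wPre
    module
  · rw [vPre_sub_wPre]
    by_cases h : v - w = 0
    · simp [h, direction]
    · exact direction_smul (norm_pos_iff.2 h) _ _

/-- The collision preserves `|v - v_*|` and exchanges the two unit vectors whose inner product is
`cos θ`. -/
lemma kernelB_collide {γ : ℝ} (hγ : γ ≠ 0) (b : ℝ → ℝ) (p : Vel d × Vel d × Sph d) :
    kernelB γ b (collide p).1 (collide p).2.1 (collide p).2.2 = kernelB γ b p.1 p.2.1 p.2.2 := by
  obtain ⟨v, w, σ⟩ := p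
  simp only [collide, kernelB, norm_vPre_sub_wPre]
  by_cases h : v - w = 0
  · simp [h, Real.zero_rpow hγ]
  · congr 2
    have h' : ‖v - w‖ ≠ 0 := by simpa using h
    rw [cosDev, cosDev, norm_vPre_sub_wPre, vPre_sub_wPre, smul_smul, inv_mul_cancel₀ h', one_smul,
      coe_direction, if_neg h, real_inner_comm]

/-! ### Angular averages against an even kernel. -/

/-- The surface measure of a set is a multiple of the volume of the cone over it, and Lebesgue
measure is invariant under `x ↦ -x`. -/
lemma measurePreserving_neg_surf :
    MeasurePreserving (fun σ : Sph d => -σ) (surf d) (surf d) := by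
  have hm : Measurable fun σ : Sph d => -σ := continuous_neg.measurable
  refine ⟨hm, Measure.ext fun s hs => ?_⟩
  rw [Measure.map_apply hm hs]
  unfold surf
  rw [Measure.toSphere_apply' _ (hm hs), Measure.toSphere_apply' _ hs]
  congr 1
  rw [← Measure.measure_neg]
  congr 1
  ext x
  simp only [Set.mem_neg, Set.mem_smul, Set.mem_image, Set.mem_preimage]
  constructor
  · rintro ⟨r, hr, _, ⟨σ, hσ, rfl⟩, h⟩
    exact ⟨r, hr, _, ⟨-σ, hσ, rfl⟩, by rw [← neg_inj, ← h]; simp⟩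
  · rintro ⟨r, hr, _, ⟨σ, hσ, rfl⟩, h⟩
    exact ⟨r, hr, _, ⟨-σ, by simpa using hσ, rfl⟩, by rw [← h]; simp⟩

lemma inner_mem_Icc {e : Vel d} (he : ‖e‖ ≤ 1) (σ : Sph d) :
    inner ℝ e (σ : Vel d) ∈ Icc (-1 : ℝ) 1 := by
  refine abs_le.1 ((abs_real_inner_le_norm _ _).trans ?_)
  rw [norm_coe_sph, mul_one]
  exact he

lemma cosDev_mem_Icc (v w : Vel d) (σ : Sph d) : cosDev v w σ ∈ Icc (-1 : ℝ) 1 := by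
  refine inner_mem_Icc ?_ σ
  rw [norm_smul, norm_inv, norm_norm]
  exact inv_mul_le_one

namespace IsBoundedAngularKernel

variable {b : ℝ → ℝ}

lemma integrable (hb : IsBoundedAngularKernel d b) {e : Vel d} (he : ‖e‖ = 1) :
    Integrable (fun σ : Sph d => b (inner ℝ e (σ : Vel d))) (surf d) := by
  by_contra h
  have := hb.norm_one e he
  rw [integral_undef h] at this
  exact zero_ne_one this

lemma lintegral_eq_one (hb : IsBoundedAngularKernel d b) {e : Vel d} (he : ‖e‖ = 1) :
    ∫⁻ σ : Sph d, ENNReal.ofReal (b (inner ℝ e (σ : Vel d))) ∂(surf d) = 1 := by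
  rw [← ofReal_integral_eq_lintegral_ofReal (hb.integrable he), hb.norm_one e he,
    ENNReal.ofReal_one]
  exact Filter.Eventually.of_forall fun σ => hb.nonneg _ (inner_mem_Icc he.le σ)

lemma integrable_mul_inner (hb : IsBoundedAngularKernel d b) {e : Vel d} (he : ‖e‖ = 1) :
    Integrable (fun σ : Sph d => b (inner ℝ e (σ : Vel d)) * inner ℝ e (σ : Vel d)) (surf d) := by
  refine (hb.integrable he).mul_bdd (c := 1) (by fun_prop) ?_
  exact Filter.Eventually.of_forall fun σ => by
    rw [Real.norm_eq_abs]
    exact abs_le.2 (inner_mem_Icc he.le σ)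

/-- The first angular moment of an even kernel vanishes. -/
lemma integral_mul_inner (hb : IsBoundedAngularKernel d b) {e : Vel d} (he : ‖e‖ = 1) :
    ∫ σ : Sph d, b (inner ℝ e (σ : Vel d)) * inner ℝ e (σ : Vel d) ∂(surf d) = 0 := by
  have hemb : MeasurableEmbedding fun σ : Sph d => -σ :=
    (Homeomorph.neg (Sph d)).measurableEmbedding
  have h := measurePreserving_neg_surf.integral_comp hemb
    fun σ : Sph d => b (inner ℝ e (σ : Vel d)) * inner ℝ e (σ : Vel d)
  have h2 : ∀ σ : Sph d, b (inner ℝ e ((-σ : Sph d) : Vel d)) * inner ℝ e ((-σ : Sph d) : Vel d) =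
      -(b (inner ℝ e (σ : Vel d)) * inner ℝ e (σ : Vel d)) := by
    intro σ
    have : ((-σ : Sph d) : Vel d) = -(σ : Vel d) := rfl
    rw [this, inner_neg_right, hb.even _ (inner_mem_Icc he.le σ), mul_neg]
  simp only [h2, integral_neg] at h
  linarith

/-- This is the coefficient of `|v|^s` in the gain estimate. Its being exactly one is what lets the
loss term cancel it. -/
lemma lintegral_mul_one_add_inner (hb : IsBoundedAngularKernel d b) {e : Vel d} (he : ‖e‖ = 1) :
    ∫⁻ σ : Sph d, ENNReal.ofReal (b (inner ℝ e (σ : Vel d)) * (1 + inner ℝ e (σ : Vel d)))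
      ∂(surf d) = 1 := by
  have hi := (hb.integrable he).add (hb.integrable_mul_inner he)
  have heq : (fun σ : Sph d => b (inner ℝ e (σ : Vel d)) * (1 + inner ℝ e (σ : Vel d))) =
      (fun σ : Sph d => b (inner ℝ e (σ : Vel d))) +
        fun σ : Sph d => b (inner ℝ e (σ : Vel d)) * inner ℝ e (σ : Vel d) := by
    funext σ
    simp only [Pi.add_apply]
    ring
  rw [← ofReal_integral_eq_lintegral_ofReal (by rw [heq]; exact hi), heq,
    integral_add' (hb.integrable he) (hb.integrable_mul_inner he), hb.norm_one e he,
    hb.integral_mul_inner he, add_zero, ENNReal.ofReal_one]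
  refine Filter.Eventually.of_forall fun σ => ?_
  have h1 := inner_mem_Icc he.le σ
  exact mul_nonneg (hb.nonneg _ h1) (by linarith [h1.1])

end IsBoundedAngularKernel

/-! ### Pointwise and angular bounds on `|v'|^s`. -/

/-- A quantitative form of the convexity of `x ↦ x ^ s`. -/
lemma exists_add_rpow_le {s : ℝ} (hs : 1 < s) :
    ∃ C : ℝ, 0 ≤ C ∧ ∀ x y : ℝ, 0 ≤ x → 0 ≤ y → (x + y) ^ s ≤ 2 * x ^ s + C * y ^ s := by
  -- Convexity is applied to `x + y = a (x / a) + (1 - a) (y / (1 - a))`, and `a` is chosen so that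
  -- `a^(1 - s) = 2`.
  set a : ℝ := (2 : ℝ) ^ (-(1 / (s - 1))) with ha
  have hs1 : 0 < s - 1 := by linarith
  have ha0 : 0 < a := by positivity
  have ha1 : a < 1 := Real.rpow_lt_one_of_one_lt_of_neg (by norm_num) (by
    have : 0 < 1 / (s - 1) := by positivity
    linarith)
  have hb0 : 0 < 1 - a := by linarith
  have hpow : ∀ {c x : ℝ}, 0 < c → 0 ≤ x → c * (x / c) ^ s = c ^ (1 - s) * x ^ s := by
    intro c x hc hx
    rw [Real.div_rpow hx hc.le, Real.rpow_sub hc, Real.rpow_one]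
    ring
  have ha2 : a ^ (1 - s) = 2 := by
    rw [ha, ← Real.rpow_mul (by norm_num)]
    have : -(1 / (s - 1)) * (1 - s) = 1 := by
      field_simp
      ring
    rw [this, Real.rpow_one]
  refine ⟨(1 - a) ^ (1 - s), by positivity, fun x y hx hy => ?_⟩
  have h := (convexOn_rpow hs.le).2 (mem_Ici.2 (div_nonneg hx ha0.le))
    (mem_Ici.2 (div_nonneg hy hb0.le)) ha0.le hb0.le (by ring)
  simp only [smul_eq_mul] at h
  rw [hpow ha0 hx, hpow hb0 hy, ha2, mul_div_cancel₀ _ ha0.ne', mul_div_cancel₀ _ hb0.ne'] at h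
  exact h

lemma norm_mul_cosDev (v w : Vel d) (σ : Sph d) :
    ‖v - w‖ * cosDev v w σ = inner ℝ (v - w) (σ : Vel d) := by
  by_cases h : v - w = 0
  · simp [h]
  · have : ‖v - w‖ ≠ 0 := by simpa using h
    rw [cosDev, real_inner_smul_left, ← mul_assoc, mul_inv_cancel₀ this, one_mul]

lemma norm_vPre_le (v w : Vel d) (σ : Sph d) :
    ‖vPre v w σ‖ ≤ Real.sqrt ((1 + cosDev v w σ) / 2) * ‖v‖ + 2 * ‖w‖ := by
  have hx := cosDev_mem_Icc v w σ
  -- Here `c = cos (θ / 2)`.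
  set c := Real.sqrt ((1 + cosDev v w σ) / 2) with hc
  have hc0 : 0 ≤ c := Real.sqrt_nonneg _
  have hc1 : c ≤ 1 := Real.sqrt_le_one.2 (by linarith [hx.2])
  have hc2 : c ^ 2 = (1 + cosDev v w σ) / 2 := Real.sq_sqrt (by linarith [hx.1])
  have hv : vPre v w σ = w + (1 / 2 : ℝ) • ((v - w) + ‖v - w‖ • (σ : Vel d)) := by
    unfold vPre
    module
  have hn : ‖(v - w) + ‖v - w‖ • (σ : Vel d)‖ = 2 * (‖v - w‖ * c) := by
    rw [← sq_eq_sq₀ (norm_nonneg _) (by positivity), norm_add_sq_real, inner_smul_right,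
      ← norm_mul_cosDev, norm_smul, norm_norm, norm_coe_sph]
    linear_combination (-4) * ‖v - w‖ ^ 2 * hc2
  calc ‖vPre v w σ‖ ≤ ‖w‖ + ‖(1 / 2 : ℝ) • ((v - w) + ‖v - w‖ • (σ : Vel d))‖ := by
        rw [hv]
        exact norm_add_le _ _
    _ = ‖w‖ + ‖v - w‖ * c := by
        rw [norm_smul, hn, Real.norm_of_nonneg (by norm_num)]
        ring
    _ ≤ ‖w‖ + (‖v‖ + ‖w‖) * c := by
        gcongr
        exact norm_sub_le _ _
    _ ≤ c * ‖v‖ + 2 * ‖w‖ := by nlinarith [norm_nonneg w]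

/-- Since `c ≤ 1` and `s ≥ 2`, one has `c^s ≤ c^2 = (1 + cos θ) / 2`. This half absorbs the factor
`2` of the convexity inequality. -/
lemma exists_norm_vPre_rpow_le (d : ℕ) {s : ℝ} (hs : 2 ≤ s) :
    ∃ C : ℝ, 0 ≤ C ∧ ∀ (v w : Vel d) (σ : Sph d),
      ‖vPre v w σ‖ ^ s ≤ (1 + cosDev v w σ) * ‖v‖ ^ s + C * ‖w‖ ^ s := by
  obtain ⟨C, hC, h⟩ := exists_add_rpow_le (s := s) (by linarith)
  refine ⟨C * 2 ^ s, by positivity, fun v w σ => ?_⟩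
  have hx := cosDev_mem_Icc v w σ
  have hle := norm_vPre_le v w σ
  set c := Real.sqrt ((1 + cosDev v w σ) / 2) with hc
  have hc0 : 0 ≤ c := Real.sqrt_nonneg _
  have hc1 : c ≤ 1 := Real.sqrt_le_one.2 (by linarith [hx.2])
  have hc2 : c ^ 2 = (1 + cosDev v w σ) / 2 := Real.sq_sqrt (by linarith [hx.1])
  have hcs : c ^ s ≤ (1 + cosDev v w σ) / 2 := by
    rw [← hc2, ← Real.rpow_natCast c 2]
    exact Real.rpow_le_rpow_of_exponent_ge' hc0 hc1 (by norm_num) (by exact_mod_cast hs)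
  calc ‖vPre v w σ‖ ^ s ≤ (c * ‖v‖ + 2 * ‖w‖) ^ s :=
        Real.rpow_le_rpow (norm_nonneg _) hle (by linarith)
    _ ≤ 2 * (c * ‖v‖) ^ s + C * (2 * ‖w‖) ^ s := h _ _ (by positivity) (by positivity)
    _ = 2 * c ^ s * ‖v‖ ^ s + C * 2 ^ s * ‖w‖ ^ s := by
        rw [Real.mul_rpow hc0 (norm_nonneg _), Real.mul_rpow (by norm_num) (norm_nonneg _)]
        ring
    _ ≤ (1 + cosDev v w σ) * ‖v‖ ^ s + C * 2 ^ s * ‖w‖ ^ s := by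
        gcongr
        linarith

lemma kernelB_nonneg {b : ℝ → ℝ} (hb : IsBoundedAngularKernel d b) (γ : ℝ) (v w : Vel d)
    (σ : Sph d) : 0 ≤ kernelB γ b v w σ :=
  mul_nonneg (by positivity) (hb.nonneg _ (cosDev_mem_Icc v w σ))

lemma maxwellian_nonneg (v : Vel d) : 0 ≤ maxwellian v := by
  unfold maxwellian
  positivity

lemma measurable_maxwellian : Measurable (maxwellian (d := d)) := by
  unfold maxwellian
  fun_prop

lemma measurable_vPre : Measurable fun p : Vel d × Vel d × Sph d => vPre p.1 p.2.1 p.2.2 := by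
  unfold vPre
  fun_prop

lemma measurable_wPre : Measurable fun p : Vel d × Vel d × Sph d => wPre p.1 p.2.1 p.2.2 := by
  unfold wPre
  fun_prop

lemma measurable_kernelB {b : ℝ → ℝ} (hb : Measurable b) (γ : ℝ) :
    Measurable fun p : Vel d × Vel d × Sph d => kernelB γ b p.1 p.2.1 p.2.2 := by
  unfold kernelB cosDev
  exact (by fun_prop : Measurable fun p : Vel d × Vel d × Sph d => ‖p.1 - p.2.1‖ ^ γ).mul
    (hb.comp (by fun_prop))

lemma norm_normalize {z : Vel d} (hz : z ≠ 0) : ‖‖z‖⁻¹ • z‖ = 1 := by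
  simp [norm_smul, hz]

lemma lintegral_kernelB {b : ℝ → ℝ} (hb : IsBoundedAngularKernel d b) {γ : ℝ} (hγ : γ ≠ 0)
    (v w : Vel d) :
    ∫⁻ σ, ENNReal.ofReal (kernelB γ b v w σ) ∂(surf d) = ENNReal.ofReal (‖v - w‖ ^ γ) := by
  by_cases h : v - w = 0
  -- On the diagonal the convention `0 ^ γ = 0` makes both sides vanish.
  · simp [kernelB, h, Real.zero_rpow hγ]
  · simp_rw [kernelB, ENNReal.ofReal_mul (Real.rpow_nonneg (norm_nonneg (v - w)) γ)]
    rw [lintegral_const_mul' _ _ ENNReal.ofReal_ne_top]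
    unfold cosDev
    rw [hb.lintegral_eq_one (norm_normalize h), mul_one]

lemma exists_lintegral_kernelB_mul_rpow_le {b : ℝ → ℝ} (hb : IsBoundedAngularKernel d b) {γ : ℝ}
    (hγ : γ ≠ 0) {s : ℝ} (hs : 2 ≤ s) :
    ∃ C : ℝ, 0 ≤ C ∧ ∀ v w : Vel d,
      ∫⁻ σ, ENNReal.ofReal (kernelB γ b v w σ) * ENNReal.ofReal (‖vPre v w σ‖ ^ s) ∂(surf d) ≤
        ENNReal.ofReal (‖v - w‖ ^ γ) *
          (ENNReal.ofReal (‖v‖ ^ s) + ENNReal.ofReal (C * ‖w‖ ^ s)) := by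
  obtain ⟨C, hC, hle⟩ := exists_norm_vPre_rpow_le d hs
  refine ⟨C, hC, fun v w => ?_⟩
  by_cases h : v - w = 0
  · simp [kernelB, h, Real.zero_rpow hγ]
  have h1 : ∀ σ, ENNReal.ofReal (kernelB γ b v w σ) * ENNReal.ofReal (‖vPre v w σ‖ ^ s) ≤
      ENNReal.ofReal (‖v - w‖ ^ γ) *
        (ENNReal.ofReal (b (cosDev v w σ) * (1 + cosDev v w σ)) * ENNReal.ofReal (‖v‖ ^ s) +
          ENNReal.ofReal (b (cosDev v w σ)) * ENNReal.ofReal (C * ‖w‖ ^ s)) := by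
    intro σ
    have hx := cosDev_mem_Icc v w σ
    have hbx := hb.nonneg _ hx
    have hx1 : 0 ≤ 1 + cosDev v w σ := by linarith [hx.1]
    rw [← ENNReal.ofReal_mul (kernelB_nonneg hb γ v w σ), ← ENNReal.ofReal_mul (by positivity),
      ← ENNReal.ofReal_mul hbx, ← ENNReal.ofReal_add (by positivity) (by positivity),
      ← ENNReal.ofReal_mul (by positivity)]
    refine ENNReal.ofReal_le_ofReal ?_
    rw [kernelB, mul_assoc]
    refine mul_le_mul_of_nonneg_left ?_ (by positivity)
    calc b (cosDev v w σ) * ‖vPre v w σ‖ ^ s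
        ≤ b (cosDev v w σ) * ((1 + cosDev v w σ) * ‖v‖ ^ s + C * ‖w‖ ^ s) :=
          mul_le_mul_of_nonneg_left (hle v w σ) hbx
      _ = _ := by ring
  have hmc : Measurable fun σ : Sph d => b (cosDev v w σ) := by
    unfold cosDev
    exact hb.measurable.comp (by fun_prop)
  refine (lintegral_mono h1).trans_eq ?_
  rw [lintegral_const_mul' _ _ ENNReal.ofReal_ne_top, lintegral_add_right _ (hmc.ennreal_ofReal.mul_const _),
    lintegral_mul_const' _ _ ENNReal.ofReal_ne_top, lintegral_mul_const' _ _ ENNReal.ofReal_ne_top]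
  unfold cosDev
  rw [hb.lintegral_mul_one_add_inner (norm_normalize h), hb.lintegral_eq_one (norm_normalize h),
    one_mul, one_mul]

/-! ### Gaussian convolutions and the collision frequency. -/

lemma nontrivial_vel (hd : 0 < d) : Nontrivial (Vel d) := by
  have : Nonempty (Fin d) := ⟨⟨0, hd⟩⟩
  infer_instance

lemma integrableOn_norm_rpow_ball (hd : 0 < d) {γ : ℝ} (hγ : -(d : ℝ) < γ) :
    IntegrableOn (fun z : Vel d => ‖z‖ ^ γ) (Metric.ball 0 1) := by
  have := nontrivial_vel hd
  rw [integrableOn_fun_norm_addHaar (volume : Measure (Vel d)) (f := fun r : ℝ => r ^ γ),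
    finrank_euclideanSpace_fin]
  have h := (intervalIntegral.integrableOn_Ioo_rpow_iff (s := (d : ℝ) - 1 + γ) zero_lt_one).2
    (by linarith)
  refine h.congr_fun (fun r hr => ?_) measurableSet_Ioo
  simp only [smul_eq_mul]
  rw [Real.rpow_add hr.1, ← Real.rpow_natCast, Nat.cast_sub hd, Nat.cast_one]

lemma integrable_exp_neg_norm_sq (d : ℕ) :
    Integrable fun w : Vel d => Real.exp (-‖w‖ ^ 2 / 4) := by
  have h := (GaussianFourier.integrable_cexp_neg_mul_sq_norm_add (V := Vel d) (b := 1 / 4)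
    (by norm_num) 0 0).norm
  refine h.congr (Filter.Eventually.of_forall fun w => ?_)
  simp only [Complex.norm_exp]
  congr 1
  have : (-(1 / 4 : ℂ) * (‖w‖ : ℂ) ^ 2 + 0 * (inner ℝ (0 : Vel d) w : ℝ)) =
    ((-‖w‖ ^ 2 / 4 : ℝ) : ℂ) := by
    push_cast
    ring
  rw [this, Complex.ofReal_re]

lemma exists_rpow_mul_exp_le {s : ℝ} (hs : 0 < s) :
    ∃ D : ℝ, 0 ≤ D ∧ ∀ r : ℝ, 0 ≤ r → r ^ s * Real.exp (-r ^ 2 / 2) ≤ D * Real.exp (-r ^ 2 / 4) := by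
  refine ⟨(2 * s) ^ (s / 2), by positivity, fun r hr => ?_⟩
  -- From `x ≤ e^x` at `x = r^2 / (2 s)`: raised to the power `s / 2`, it costs exactly half of the
  -- Gaussian decay.
  have h1 : r ^ 2 ≤ 2 * s * Real.exp (r ^ 2 / (2 * s)) := by
    have := Real.add_one_le_exp (r ^ 2 / (2 * s))
    calc r ^ 2 = 2 * s * (r ^ 2 / (2 * s)) := by field_simp
      _ ≤ _ := by
        gcongr
        linarith
  have h2 : r ^ s ≤ (2 * s) ^ (s / 2) * Real.exp (r ^ 2 / 4) := by
    calc r ^ s = (r ^ 2) ^ (s / 2) := by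
          rw [← Real.rpow_natCast r 2, ← Real.rpow_mul hr]
          congr 1
          push_cast
          ring
      _ ≤ (2 * s * Real.exp (r ^ 2 / (2 * s))) ^ (s / 2) :=
          Real.rpow_le_rpow (by positivity) h1 (by positivity)
      _ = _ := by
          rw [Real.mul_rpow (by positivity) (Real.exp_nonneg _), ← Real.exp_mul]
          congr 2
          field_simp
          norm_num
  calc r ^ s * Real.exp (-r ^ 2 / 2)
      ≤ (2 * s) ^ (s / 2) * Real.exp (r ^ 2 / 4) * Real.exp (-r ^ 2 / 2) := by gcongr
    _ = _ := by
        rw [mul_assoc, ← Real.exp_add]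
        congr 2
        ring

/-- Convolutions of locally integrable powers with a Gaussian are bounded. -/
lemma exists_lintegral_rpow_mul_exp_le (hd : 0 < d) {γ : ℝ} (hγ : -(d : ℝ) < γ) (hγ0 : γ < 0) :
    ∃ K : ℝ, 0 ≤ K ∧ ∀ v : Vel d,
      ∫⁻ w : Vel d, ENNReal.ofReal (‖v - w‖ ^ γ) * ENNReal.ofReal (Real.exp (-‖w‖ ^ 2 / 4)) ≤
        ENNReal.ofReal K := by
  set φ : Vel d → ENNReal := (Metric.ball 0 1).indicator fun z => ENNReal.ofReal (‖z‖ ^ γ) with hφ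
  have hφm : Measurable φ := Measurable.indicator (by fun_prop) measurableSet_ball
  set I := ∫⁻ z, φ z with hI
  set J := ∫⁻ w : Vel d, ENNReal.ofReal (Real.exp (-‖w‖ ^ 2 / 4)) with hJ
  have hIfin : I ≠ ⊤ := by
    rw [hI, hφ, lintegral_indicator measurableSet_ball]
    exact (integrableOn_norm_rpow_ball hd hγ).lintegral_lt_top.ne
  have hJfin : J ≠ ⊤ := (integrable_exp_neg_norm_sq d).lintegral_lt_top.ne
  refine ⟨(I + J).toReal, ENNReal.toReal_nonneg, fun v => ?_⟩
  rw [ENNReal.ofReal_toReal (ENNReal.add_ne_top.2 ⟨hIfin, hJfin⟩)]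
  -- For `|v - w| < 1` the Gaussian is at most one; elsewhere the power is, since `γ < 0`.
  have hle : ∀ w : Vel d,
      ENNReal.ofReal (‖v - w‖ ^ γ) * ENNReal.ofReal (Real.exp (-‖w‖ ^ 2 / 4)) ≤
        φ (v - w) + ENNReal.ofReal (Real.exp (-‖w‖ ^ 2 / 4)) := by
    intro w
    by_cases h : v - w ∈ Metric.ball (0 : Vel d) 1
    · refine le_add_right ?_
      rw [hφ, indicator_of_mem h]
      refine mul_le_of_le_one_right' ?_
      rw [ENNReal.ofReal_le_one, Real.exp_le_one_iff]
      have := sq_nonneg ‖w‖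
      linarith
    · refine le_add_left ?_
      refine mul_le_of_le_one_left' ?_
      rw [ENNReal.ofReal_le_one]
      refine Real.rpow_le_one_of_one_le_of_nonpos ?_ hγ0.le
      simpa using h
  refine (lintegral_mono hle).trans_eq ?_
  rw [lintegral_add_right _ (by fun_prop), lintegral_sub_left_eq_self φ v]

/-- The collision frequency `ν(v) = ∫ |v - v_*|^γ M(v_*) dv_*`. -/
def collisionFrequency (γ : ℝ) (v : Vel d) : ENNReal :=
  ∫⁻ w : Vel d, ENNReal.ofReal (‖v - w‖ ^ γ) * ENNReal.ofReal (maxwellian w)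

lemma measurable_collisionFrequency (γ : ℝ) : Measurable (collisionFrequency (d := d) γ) := by
  unfold collisionFrequency
  have hM := measurable_maxwellian (d := d)
  have : Measurable fun p : Vel d × Vel d =>
      ENNReal.ofReal (‖p.1 - p.2‖ ^ γ) * ENNReal.ofReal (maxwellian p.2) := by fun_prop
  exact this.lintegral_prod_right'

lemma exists_maxwellian_rpow_le (d : ℕ) {s : ℝ} (hs : 0 ≤ s) :
    ∃ D : ℝ, 0 ≤ D ∧ ∀ w : Vel d, ‖w‖ ^ s * maxwellian w ≤ D * Real.exp (-‖w‖ ^ 2 / 4) := by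
  set a : ℝ := 1 / (2 * Real.pi) ^ ((d : ℝ) / 2) with ha
  have ha0 : 0 ≤ a := by positivity
  rcases hs.eq_or_lt with rfl | hs
  · refine ⟨a, ha0, fun w => ?_⟩
    rw [Real.rpow_zero, one_mul, maxwellian, ← ha]
    have hw : (0 : ℝ) ≤ ‖w‖ ^ 2 := by positivity
    exact mul_le_mul_of_nonneg_left (Real.exp_le_exp.2 (by linarith)) ha0
  · obtain ⟨D, hD, h⟩ := exists_rpow_mul_exp_le hs
    refine ⟨a * D, by positivity, fun w => ?_⟩
    rw [maxwellian, ← ha]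
    calc ‖w‖ ^ s * (a * Real.exp (-‖w‖ ^ 2 / 2)) = a * (‖w‖ ^ s * Real.exp (-‖w‖ ^ 2 / 2)) := by
          ring
      _ ≤ a * (D * Real.exp (-‖w‖ ^ 2 / 4)) := by
          exact mul_le_mul_of_nonneg_left (h ‖w‖ (norm_nonneg w)) ha0
      _ = _ := by ring

lemma exists_lintegral_rpow_mul_maxwellian_le (hd : 0 < d) {γ : ℝ} (hγ : -(d : ℝ) < γ)
    (hγ0 : γ < 0) {s : ℝ} (hs : 0 ≤ s) :
    ∃ K : ℝ, 0 ≤ K ∧ ∀ v : Vel d,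
      ∫⁻ w : Vel d, ENNReal.ofReal (‖v - w‖ ^ γ) * ENNReal.ofReal (‖w‖ ^ s * maxwellian w) ≤
        ENNReal.ofReal K := by
  obtain ⟨K, hK, h⟩ := exists_lintegral_rpow_mul_exp_le hd hγ hγ0
  obtain ⟨D, hD, hM⟩ := exists_maxwellian_rpow_le d hs
  refine ⟨D * K, by positivity, fun v => ?_⟩
  calc ∫⁻ w : Vel d, ENNReal.ofReal (‖v - w‖ ^ γ) * ENNReal.ofReal (‖w‖ ^ s * maxwellian w)
      ≤ ∫⁻ w : Vel d, ENNReal.ofReal D *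
          (ENNReal.ofReal (‖v - w‖ ^ γ) * ENNReal.ofReal (Real.exp (-‖w‖ ^ 2 / 4))) := by
        refine lintegral_mono fun w => ?_
        rw [mul_left_comm, ← ENNReal.ofReal_mul hD]
        exact mul_le_mul_right (ENNReal.ofReal_le_ofReal (hM w)) _
    _ = ENNReal.ofReal D * _ := lintegral_const_mul' _ _ ENNReal.ofReal_ne_top
    _ ≤ ENNReal.ofReal D * ENNReal.ofReal K := by gcongr; exact h v
    _ = _ := (ENNReal.ofReal_mul hD).symm

lemma exists_collisionFrequency_le (hd : 0 < d) {γ : ℝ} (hγ : -(d : ℝ) < γ) (hγ0 : γ < 0) :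
    ∃ K : ℝ, 0 ≤ K ∧ ∀ v : Vel d, collisionFrequency γ v ≤ ENNReal.ofReal K := by
  obtain ⟨K, hK, h⟩ := exists_lintegral_rpow_mul_maxwellian_le hd hγ hγ0 le_rfl
  exact ⟨K, hK, fun v => by simpa [collisionFrequency] using h v⟩

/-! ### The gain operator in weak form and its moments. -/

/-- The gain part of the linear Boltzmann operator, acting on nonnegative functions. -/
def gain (γ : ℝ) (b : ℝ → ℝ) (g : Vel d → ENNReal) (v : Vel d) : ENNReal :=
  ∫⁻ q : Vel d × Sph d, ENNReal.ofReal (kernelB γ b v q.1 q.2) *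
    (g (vPre v q.1 q.2) * ENNReal.ofReal (maxwellian (wPre v q.1 q.2)))
    ∂((volume : Measure (Vel d)).prod (surf d))

/-- The weak form of the gain operator. -/
lemma lintegral_gain [Nontrivial (Vel d)] {γ : ℝ} (hγ : γ ≠ 0) {b : ℝ → ℝ} (hb : Measurable b)
    (W g : Vel d → ENNReal) (hW : Measurable W) (hg : Measurable g) :
    ∫⁻ v, W v * gain γ b g v =
      ∫⁻ v, g v * ∫⁻ w, ENNReal.ofReal (maxwellian w) *
        ∫⁻ σ, ENNReal.ofReal (kernelB γ b v w σ) * W (vPre v w σ) ∂(surf d) := by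
  have hk := (measurable_kernelB (d := d) hb γ).ennreal_ofReal
  have hM := measurable_maxwellian (d := d)
  have hv := measurable_vPre (d := d)
  obtain ⟨H, hH⟩ : ∃ H : Vel d × Vel d × Sph d → ENNReal, ∀ p, H p =
    g p.1 * (ENNReal.ofReal (maxwellian p.2.1) *
      (ENNReal.ofReal (kernelB γ b p.1 p.2.1 p.2.2) * W (vPre p.1 p.2.1 p.2.2))) :=
    ⟨_, fun p => rfl⟩
  have hHin : Measurable fun p : Vel d × Vel d × Sph d =>
      ENNReal.ofReal (kernelB γ b p.1 p.2.1 p.2.2) * W (vPre p.1 p.2.1 p.2.2) :=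
    hk.mul (hW.comp hv)
  have hHmid : Measurable fun p : Vel d × Vel d × Sph d => ENNReal.ofReal (maxwellian p.2.1) *
      (ENNReal.ofReal (kernelB γ b p.1 p.2.1 p.2.2) * W (vPre p.1 p.2.1 p.2.2)) :=
    Measurable.mul (by fun_prop) hHin
  have hHm : Measurable H := by
    rw [funext hH]
    exact Measurable.mul (by fun_prop) hHmid
  -- `H` is the integrand of the right-hand side; composed with the collision it becomes that of the
  -- left-hand side.
  have hcol : ∀ p, H (collide p) = W p.1 * (ENNReal.ofReal (kernelB γ b p.1 p.2.1 p.2.2) *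
      (g (vPre p.1 p.2.1 p.2.2) * ENNReal.ofReal (maxwellian (wPre p.1 p.2.1 p.2.2)))) := by
    intro p
    rw [hH, kernelB_collide hγ, ← collide_fst (collide p), collide_collide, collide_fst,
      collide_snd_fst]
    ring
  have hmeas2 : Measurable fun p : Vel d × Vel d × Sph d =>
      ENNReal.ofReal (kernelB γ b p.1 p.2.1 p.2.2) *
      (g (vPre p.1 p.2.1 p.2.2) * ENNReal.ofReal (maxwellian (wPre p.1 p.2.1 p.2.2))) :=
    hk.mul ((hg.comp hv).mul (hM.comp measurable_wPre).ennreal_ofReal)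
  have h1 : ∀ v, W v * gain γ b g v =
      ∫⁻ q, H (collide (v, q)) ∂((volume : Measure (Vel d)).prod (surf d)) := by
    intro v
    have hm := hmeas2.comp (measurable_prodMk_left (x := v))
    simp only [hcol, gain]
    exact (lintegral_const_mul _ hm).symm
  have h2 : ∀ v, ∫⁻ q, H (v, q) ∂((volume : Measure (Vel d)).prod (surf d)) =
      g v * ∫⁻ w, ENNReal.ofReal (maxwellian w) *
        ∫⁻ σ, ENNReal.ofReal (kernelB γ b v w σ) * W (vPre v w σ) ∂(surf d) := by
    intro v
    have hHv : Measurable fun q : Vel d × Sph d => ENNReal.ofReal (maxwellian q.1) *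
        (ENNReal.ofReal (kernelB γ b v q.1 q.2) * W (vPre v q.1 q.2)) :=
      (hHmid.comp (measurable_prodMk_left (x := v)) :)
    simp only [hH]
    rw [lintegral_const_mul _ hHv, lintegral_prod _ hHv.aemeasurable]
    simp only [lintegral_const_mul' _ _ ENNReal.ofReal_ne_top]
  have hHc : Measurable fun p => H (collide p) := hHm.comp measurable_collide
  have h3 := lintegral_comp_collide H hHm
  rw [collisionMeasure, lintegral_prod _ hHc.aemeasurable, lintegral_prod _ hHm.aemeasurable] at h3
  simp only [h1, h3, h2]

lemma lintegral_maxwellian_mul_kernelB {γ : ℝ} (hγ : γ ≠ 0) {b : ℝ → ℝ}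
    (hb : IsBoundedAngularKernel d b) (v : Vel d) :
    ∫⁻ w, ENNReal.ofReal (maxwellian w) * ∫⁻ σ, ENNReal.ofReal (kernelB γ b v w σ) ∂(surf d) =
      collisionFrequency γ v := by
  simp only [lintegral_kernelB hb hγ, collisionFrequency, mul_comm]

/-- The moment estimate for the gain operator. -/
lemma exists_lintegral_rpow_gain_le (hd : 0 < d) {γ : ℝ} (hγ : -(d : ℝ) < γ) (hγ0 : γ < 0)
    {b : ℝ → ℝ} (hb : IsBoundedAngularKernel d b) {s : ℝ} (hs : 2 ≤ s) :
    ∃ C : ℝ, 0 ≤ C ∧ ∀ g : Vel d → ENNReal, Measurable g →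
      ∫⁻ v, ENNReal.ofReal (‖v‖ ^ s) * gain γ b g v ≤
        ∫⁻ v, g v * (ENNReal.ofReal (‖v‖ ^ s) * collisionFrequency γ v + ENNReal.ofReal C) := by
  have := nontrivial_vel hd
  obtain ⟨C, hC, hP⟩ := exists_lintegral_kernelB_mul_rpow_le hb hγ0.ne hs
  obtain ⟨K, hK, hKle⟩ := exists_lintegral_rpow_mul_maxwellian_le hd hγ hγ0 (s := s) (by linarith)
  refine ⟨C * K, by positivity, fun g hg => ?_⟩
  rw [lintegral_gain hγ0.ne hb.measurable _ g (by fun_prop) hg]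
  refine lintegral_mono fun v => ?_
  gcongr
  have hM := measurable_maxwellian (d := d)
  calc ∫⁻ w, ENNReal.ofReal (maxwellian w) *
        ∫⁻ σ, ENNReal.ofReal (kernelB γ b v w σ) * ENNReal.ofReal (‖vPre v w σ‖ ^ s) ∂(surf d)
      ≤ ∫⁻ w, (ENNReal.ofReal (‖v‖ ^ s) *
          (ENNReal.ofReal (‖v - w‖ ^ γ) * ENNReal.ofReal (maxwellian w)) +
          ENNReal.ofReal C *
          (ENNReal.ofReal (‖v - w‖ ^ γ) * ENNReal.ofReal (‖w‖ ^ s * maxwellian w))) := by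
        refine lintegral_mono fun w => ?_
        refine (mul_le_mul_right (hP v w) _).trans_eq ?_
        rw [ENNReal.ofReal_mul hC, ENNReal.ofReal_mul (Real.rpow_nonneg (norm_nonneg w) s)]
        ring
    _ = ENNReal.ofReal (‖v‖ ^ s) * collisionFrequency γ v + ENNReal.ofReal C *
          ∫⁻ w, ENNReal.ofReal (‖v - w‖ ^ γ) * ENNReal.ofReal (‖w‖ ^ s * maxwellian w) := by
        rw [lintegral_add_left (by fun_prop), lintegral_const_mul' _ _ ENNReal.ofReal_ne_top,
          lintegral_const_mul' _ _ ENNReal.ofReal_ne_top]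
        rfl
    _ ≤ _ := by
        rw [ENNReal.ofReal_mul hC]
        gcongr
        exact hKle v

/-! ### `L_γ` on `L¹` and estimates for `L_γ + K`. -/

/-- The loss integrand `|v - v_*|^γ b(cos θ) f(v) M(v_*)`. -/
def flux (γ : ℝ) (b : ℝ → ℝ) (h : Vel d → ℝ) (p : Vel d × Vel d × Sph d) : ℝ :=
  kernelB γ b p.1 p.2.1 p.2.2 * (h p.1 * maxwellian p.2.1)

lemma flux_collide {γ : ℝ} (hγ : γ ≠ 0) (b : ℝ → ℝ) (h : Vel d → ℝ) (p : Vel d × Vel d × Sph d) :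
    flux γ b h (collide p) = kernelB γ b p.1 p.2.1 p.2.2 *
      (h (vPre p.1 p.2.1 p.2.2) * maxwellian (wPre p.1 p.2.1 p.2.2)) := by
  rw [flux, kernelB_collide hγ, collide_fst, collide_snd_fst]

/-- The gain integrand is the loss integrand after a collision, so integrability of `flux` settles
both. -/
lemma opL_eq {γ : ℝ} (hγ : γ ≠ 0) (b : ℝ → ℝ) (h : Vel d → ℝ) (v : Vel d) :
    opL γ b h v = ∫ q, (flux γ b h (collide (v, q)) - flux γ b h (v, q))
      ∂((volume : Measure (Vel d)).prod (surf d)) := by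
  unfold opL collisionQ
  refine integral_congr_ae (Filter.Eventually.of_forall fun q => ?_)
  simp only [flux_collide hγ]
  rw [flux]
  ring

lemma measurable_flux (γ : ℝ) {b : ℝ → ℝ} (hb : Measurable b) {h : Vel d → ℝ}
    (hh : Measurable h) : Measurable (flux γ b h) := by
  have hM := measurable_maxwellian (d := d)
  unfold flux
  exact (measurable_kernelB hb γ).mul (by fun_prop)

lemma enorm_flux {b : ℝ → ℝ} (hb : IsBoundedAngularKernel d b) (γ : ℝ) (h : Vel d → ℝ)
    (p : Vel d × Vel d × Sph d) :
    ‖flux γ b h p‖ₑ = ‖h p.1‖ₑ *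
      (ENNReal.ofReal (maxwellian p.2.1) * ENNReal.ofReal (kernelB γ b p.1 p.2.1 p.2.2)) := by
  rw [flux, enorm_mul, enorm_mul, Real.enorm_of_nonneg (maxwellian_nonneg _),
    Real.enorm_of_nonneg (kernelB_nonneg hb _ _ _ _)]
  ring

lemma lintegral_maxwellian_mul_kernelB_prod {γ : ℝ} (hγ : γ ≠ 0) {b : ℝ → ℝ}
    (hb : IsBoundedAngularKernel d b) (v : Vel d) :
    ∫⁻ q : Vel d × Sph d,
      ENNReal.ofReal (maxwellian q.1) * ENNReal.ofReal (kernelB γ b v q.1 q.2)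
      ∂((volume : Measure (Vel d)).prod (surf d)) = collisionFrequency γ v := by
  have hM := measurable_maxwellian (d := d)
  have hk : Measurable fun q : Vel d × Sph d => kernelB γ b v q.1 q.2 :=
    ((measurable_kernelB hb.measurable γ).comp (measurable_prodMk_left (x := v)) :)
  rw [lintegral_prod _ (by fun_prop), ← lintegral_maxwellian_mul_kernelB hγ hb]
  simp only [lintegral_const_mul' _ _ ENNReal.ofReal_ne_top]

lemma lintegral_enorm_flux {γ : ℝ} (hγ : γ ≠ 0) {b : ℝ → ℝ} (hb : IsBoundedAngularKernel d b)
    (h : Vel d → ℝ) (v : Vel d) :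
    ∫⁻ q, ‖flux γ b h (v, q)‖ₑ ∂((volume : Measure (Vel d)).prod (surf d)) =
      ‖h v‖ₑ * collisionFrequency γ v := by
  simp only [enorm_flux hb]
  rw [lintegral_const_mul' _ _ enorm_ne_top, lintegral_maxwellian_mul_kernelB_prod hγ hb]

lemma integral_flux {γ : ℝ} (hγ : γ ≠ 0) {b : ℝ → ℝ} (hb : IsBoundedAngularKernel d b)
    (h : Vel d → ℝ) (v : Vel d) :
    ∫ q, flux γ b h (v, q) ∂((volume : Measure (Vel d)).prod (surf d)) =
      h v * (collisionFrequency γ v).toReal := by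
  have hM := measurable_maxwellian (d := d)
  have hk : Measurable fun q : Vel d × Sph d => kernelB γ b v q.1 q.2 :=
    ((measurable_kernelB hb.measurable γ).comp (measurable_prodMk_left (x := v)) :)
  have h1 : ∀ q : Vel d × Sph d,
      flux γ b h (v, q) = h v * (maxwellian q.1 * kernelB γ b v q.1 q.2) := by
    intro q
    rw [flux]
    ring
  simp only [h1]
  rw [integral_const_mul, integral_eq_lintegral_of_nonneg_ae]
  · simp only [ENNReal.ofReal_mul (maxwellian_nonneg _)]
    rw [lintegral_maxwellian_mul_kernelB_prod hγ hb]
  · exact Filter.Eventually.of_forall fun q =>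
      mul_nonneg (maxwellian_nonneg _) (kernelB_nonneg hb _ _ _ _)
  · exact (by fun_prop : Measurable fun q : Vel d × Sph d =>
      maxwellian q.1 * kernelB γ b v q.1 q.2).aestronglyMeasurable

lemma integrable_flux (hd : 0 < d) {γ : ℝ} (hγ : -(d : ℝ) < γ) (hγ0 : γ < 0) {b : ℝ → ℝ}
    (hb : IsBoundedAngularKernel d b) {h : Vel d → ℝ} (hh : Measurable h) (hi : Integrable h) :
    Integrable (flux γ b h) (collisionMeasure d) := by
  obtain ⟨K, hK, hle⟩ := exists_collisionFrequency_le hd hγ hγ0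
  have hm := measurable_flux γ hb.measurable hh
  refine ⟨hm.aestronglyMeasurable, ?_⟩
  rw [HasFiniteIntegral, collisionMeasure, lintegral_prod _ hm.enorm.aemeasurable]
  simp only [lintegral_enorm_flux hγ0.ne hb]
  calc ∫⁻ v, ‖h v‖ₑ * collisionFrequency γ v ≤ ∫⁻ v, ‖h v‖ₑ * ENNReal.ofReal K :=
        lintegral_mono fun v => mul_le_mul_right (hle v) _
    _ = (∫⁻ v, ‖h v‖ₑ) * ENNReal.ofReal K := lintegral_mul_const' _ _ ENNReal.ofReal_ne_top
    _ < ⊤ := ENNReal.mul_lt_top hi.2 ENNReal.ofReal_lt_top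

lemma integrable_flux_collide (hd : 0 < d) {γ : ℝ} (hγ : -(d : ℝ) < γ) (hγ0 : γ < 0) {b : ℝ → ℝ}
    (hb : IsBoundedAngularKernel d b) {h : Vel d → ℝ} (hh : Measurable h) (hi : Integrable h) :
    Integrable (fun p => flux γ b h (collide p)) (collisionMeasure d) := by
  have := nontrivial_vel hd
  exact measurePreserving_collide.integrable_comp_of_integrable
    (integrable_flux hd hγ hγ0 hb hh hi)

lemma integrable_opL (hd : 0 < d) {γ : ℝ} (hγ : -(d : ℝ) < γ) (hγ0 : γ < 0) {b : ℝ → ℝ}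
    (hb : IsBoundedAngularKernel d b) {h : Vel d → ℝ} (hh : Measurable h) (hi : Integrable h) :
    Integrable (opL γ b h) := by
  have h1 := ((integrable_flux_collide hd hγ hγ0 hb hh hi).sub
    (integrable_flux hd hγ hγ0 hb hh hi)).integral_prod_left
  exact h1.congr (Filter.Eventually.of_forall fun v => (opL_eq hγ0.ne b h v).symm)

/-- Needed for `L_γ` to act on classes in `L¹`: the collision preserves the measure, hence null
sets. -/
lemma opL_congr (hd : 0 < d) {γ : ℝ} (hγ : γ ≠ 0) (b : ℝ → ℝ) {h h' : Vel d → ℝ}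
    (hh : h =ᵐ[volume] h') : opL γ b h =ᵐ[volume] opL γ b h' := by
  have := nontrivial_vel hd
  have h1 : flux γ b h =ᵐ[collisionMeasure d] flux γ b h' := by
    have h2 := (Measure.quasiMeasurePreserving_fst (μ := (volume : Measure (Vel d)))
      (ν := (volume : Measure (Vel d)).prod (surf d))).ae_eq_comp hh
    filter_upwards [h2] with p hp
    simp only [Function.comp_apply] at hp
    rw [flux, flux, hp]
  have h2 := measurePreserving_collide.quasiMeasurePreserving.ae_eq_comp h1
  filter_upwards [Measure.ae_ae_of_ae_prod h1, Measure.ae_ae_of_ae_prod h2] with v hv1 hv2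
  rw [opL_eq hγ, opL_eq hγ]
  refine integral_congr_ae ?_
  filter_upwards [hv1, hv2] with q hq1 hq2
  simp only [Function.comp_apply] at hq2
  rw [hq1, hq2]

lemma opL_add (hd : 0 < d) {γ : ℝ} (hγ : -(d : ℝ) < γ) (hγ0 : γ < 0) {b : ℝ → ℝ}
    (hb : IsBoundedAngularKernel d b) {h h' : Vel d → ℝ} (hh : Measurable h) (hi : Integrable h)
    (hh' : Measurable h') (hi' : Integrable h') :
    opL γ b (h + h') =ᵐ[volume] opL γ b h + opL γ b h' := by
  have h1 := ((integrable_flux_collide hd hγ hγ0 hb hh hi).sub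
    (integrable_flux hd hγ hγ0 hb hh hi)).prod_right_ae
  have h2 := ((integrable_flux_collide hd hγ hγ0 hb hh' hi').sub
    (integrable_flux hd hγ hγ0 hb hh' hi')).prod_right_ae
  filter_upwards [h1, h2] with v hv1 hv2
  simp only [Pi.sub_apply] at hv1 hv2
  rw [Pi.add_apply, opL_eq hγ0.ne, opL_eq hγ0.ne, opL_eq hγ0.ne, ← integral_add hv1 hv2]
  refine integral_congr_ae (Filter.Eventually.of_forall fun q => ?_)
  simp only [flux, Pi.add_apply]
  ring

lemma opL_smul {γ : ℝ} (hγ : γ ≠ 0) (b : ℝ → ℝ) (c : ℝ) (h : Vel d → ℝ) :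
    opL γ b (c • h) = c • opL γ b h := by
  funext v
  rw [Pi.smul_apply, opL_eq hγ, opL_eq hγ, smul_eq_mul, ← integral_const_mul]
  refine integral_congr_ae (Filter.Eventually.of_forall fun q => ?_)
  simp only [flux, Pi.smul_apply, smul_eq_mul]
  ring

/-- With `K ≥ ν` the multiplier `K - ν` is its own absolute value, so the later cancellation of `ν`
survives the triangle inequality. -/
lemma enorm_opL_add_le (hd : 0 < d) {γ : ℝ} (hγ : -(d : ℝ) < γ) (hγ0 : γ < 0) {b : ℝ → ℝ}
    (hb : IsBoundedAngularKernel d b) {K : ℝ}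
    (hK0 : 0 ≤ K) (hK : ∀ v : Vel d, collisionFrequency γ v ≤ ENNReal.ofReal K) {h : Vel d → ℝ}
    (hh : Measurable h) (hi : Integrable h) :
    ∀ᵐ v, ‖opL γ b h v + K * h v‖ₑ ≤ gain γ b (fun v => ‖h v‖ₑ) v +
      (ENNReal.ofReal K - collisionFrequency γ v) * ‖h v‖ₑ := by
  filter_upwards [(integrable_flux_collide hd hγ hγ0 hb hh hi).prod_right_ae,
    (integrable_flux hd hγ hγ0 hb hh hi).prod_right_ae] with v hv1 hv2
  have hν : collisionFrequency γ v ≠ ⊤ := ne_top_of_le_ne_top ENNReal.ofReal_ne_top (hK v)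
  have hg : ‖∫ q, flux γ b h (collide (v, q)) ∂((volume : Measure (Vel d)).prod (surf d))‖ₑ ≤
      gain γ b (fun v => ‖h v‖ₑ) v := by
    refine (enorm_integral_le_lintegral_enorm _).trans_eq ?_
    unfold gain
    refine lintegral_congr fun q => ?_
    rw [flux_collide hγ0.ne, enorm_mul, enorm_mul, Real.enorm_of_nonneg (maxwellian_nonneg _),
      Real.enorm_of_nonneg (kernelB_nonneg hb _ _ _ _)]
  have heq : opL γ b h v + K * h v =
      ∫ q, flux γ b h (collide (v, q)) ∂((volume : Measure (Vel d)).prod (surf d)) +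
        (K - (collisionFrequency γ v).toReal) * h v := by
    rw [opL_eq hγ0.ne, integral_sub hv1 hv2, integral_flux hγ0.ne hb]
    ring
  rw [heq]
  refine (enorm_add_le _ _).trans (add_le_add hg ?_)
  rw [enorm_mul]
  refine le_of_eq ?_
  congr 1
  rw [Real.enorm_of_nonneg, ENNReal.ofReal_sub _ ENNReal.toReal_nonneg, ENNReal.ofReal_toReal hν]
  rw [sub_nonneg]
  exact ENNReal.toReal_le_of_le_ofReal hK0 (hK v)

/-- Weighted estimate for `L_γ + K`, from a weighted estimate for the gain operator. -/
lemma lintegral_mul_enorm_opL_add_le (hd : 0 < d) {γ : ℝ} (hγ : -(d : ℝ) < γ) (hγ0 : γ < 0)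
    {b : ℝ → ℝ} (hb : IsBoundedAngularKernel d b) {K : ℝ} (hK0 : 0 ≤ K)
    (hK : ∀ v : Vel d, collisionFrequency γ v ≤ ENNReal.ofReal K) {W : Vel d → ENNReal}
    (hW : Measurable W) {c : ENNReal}
    (hgain : ∀ g : Vel d → ENNReal, Measurable g →
      ∫⁻ v, W v * gain γ b g v ≤ ∫⁻ v, g v * (W v * collisionFrequency γ v + c))
    {h : Vel d → ℝ} (hh : Measurable h) (hi : Integrable h) :
    ∫⁻ v, W v * ‖opL γ b h v + K * h v‖ₑ ≤
      ENNReal.ofReal K * (∫⁻ v, W v * ‖h v‖ₑ) + c * ∫⁻ v, ‖h v‖ₑ := by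
  have hν := measurable_collisionFrequency (d := d) γ
  have hm : Measurable fun v => W v * ((ENNReal.ofReal K - collisionFrequency γ v) * ‖h v‖ₑ) :=
    hW.mul ((measurable_const.sub hν).mul hh.enorm)
  calc ∫⁻ v, W v * ‖opL γ b h v + K * h v‖ₑ
      ≤ ∫⁻ v, (W v * gain γ b (fun v => ‖h v‖ₑ) v +
          W v * ((ENNReal.ofReal K - collisionFrequency γ v) * ‖h v‖ₑ)) := by
        refine lintegral_mono_ae ?_
        filter_upwards [enorm_opL_add_le hd hγ hγ0 hb hK0 hK hh hi] with v hv
        rw [← mul_add]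
        exact mul_le_mul_right hv _
    _ = (∫⁻ v, W v * gain γ b (fun v => ‖h v‖ₑ) v) +
          ∫⁻ v, W v * ((ENNReal.ofReal K - collisionFrequency γ v) * ‖h v‖ₑ) :=
        lintegral_add_right _ hm
    _ ≤ (∫⁻ v, ‖h v‖ₑ * (W v * collisionFrequency γ v + c)) +
          ∫⁻ v, W v * ((ENNReal.ofReal K - collisionFrequency γ v) * ‖h v‖ₑ) := by
        exact add_le_add_left (hgain _ hh.enorm) _
    -- The `W ν` from the gain and the `W (K - ν)` from the multiplier add up to `W K`.
    _ = ∫⁻ v, (ENNReal.ofReal K * (W v * ‖h v‖ₑ) + c * ‖h v‖ₑ) := by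
        rw [← lintegral_add_right _ hm]
        refine lintegral_congr fun v => ?_
        conv_rhs => rw [← add_tsub_cancel_of_le (hK v)]
        ring
    _ = _ := by
        rw [lintegral_add_right _ (hh.enorm.const_mul c), lintegral_const_mul _ (hW.fun_mul hh.enorm),
          lintegral_const_mul _ hh.enorm]

lemma lintegral_enorm_opL_add_le (hd : 0 < d) {γ : ℝ} (hγ : -(d : ℝ) < γ) (hγ0 : γ < 0)
    {b : ℝ → ℝ} (hb : IsBoundedAngularKernel d b) {K : ℝ} (hK0 : 0 ≤ K)
    (hK : ∀ v : Vel d, collisionFrequency γ v ≤ ENNReal.ofReal K)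
    {h : Vel d → ℝ} (hh : Measurable h) (hi : Integrable h) :
    ∫⁻ v, ‖opL γ b h v + K * h v‖ₑ ≤ ENNReal.ofReal K * ∫⁻ v, ‖h v‖ₑ := by
  have := nontrivial_vel hd
  -- For the weight one the gain estimate is an equality with `c = 0`: collisions conserve mass.
  have key := lintegral_mul_enorm_opL_add_le hd hγ hγ0 hb hK0 hK (W := fun _ => 1)
    measurable_const (c := 0) (fun g hg => by
      rw [lintegral_gain hγ0.ne hb.measurable _ g measurable_const hg]
      simp only [mul_one, one_mul, add_zero, lintegral_maxwellian_mul_kernelB hγ0.ne hb]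
      exact le_rfl) hh hi
  simpa using key

/-- The linear Boltzmann operator is bounded on `L¹`. -/
lemma exists_opL_continuousLinearMap (hd : 0 < d) {γ : ℝ} (hγ : -(d : ℝ) < γ) (hγ0 : γ < 0)
    {b : ℝ → ℝ} (hb : IsBoundedAngularKernel d b) :
    ∃ T : (Vel d →₁[volume] ℝ) →L[ℝ] (Vel d →₁[volume] ℝ), ∀ h, T h =ᵐ[volume] opL γ b h := by
  obtain ⟨K, hK0, hK⟩ := exists_collisionFrequency_le hd hγ hγ0
  have hmeas : ∀ h : Vel d →₁[volume] ℝ, Measurable h := fun h =>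
    (Lp.stronglyMeasurable h).measurable
  have hint : ∀ h : Vel d →₁[volume] ℝ, Integrable (opL γ b h) := fun h =>
    integrable_opL hd hγ hγ0 hb (hmeas h) (L1.integrable_coeFn h)
  let T : (Vel d →₁[volume] ℝ) →ₗ[ℝ] (Vel d →₁[volume] ℝ) :=
    { toFun := fun h => (hint h).toL1 _
      map_add' := fun h h' => by
        rw [← Integrable.toL1_add, Integrable.toL1_eq_toL1_iff]
        exact (opL_congr hd hγ0.ne b (Lp.coeFn_add h h')).trans
          (opL_add hd hγ hγ0 hb (hmeas h) (L1.integrable_coeFn h) (hmeas h')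
            (L1.integrable_coeFn h'))
      map_smul' := fun c h => by
        rw [RingHom.id_apply, ← Integrable.toL1_smul', Integrable.toL1_eq_toL1_iff]
        refine (opL_congr hd hγ0.ne b (Lp.coeFn_smul c h)).trans ?_
        rw [opL_smul hγ0.ne] }
  refine ⟨T.mkContinuous (2 * K) fun h => ?_, fun h => (hint h).coeFn_toL1⟩
  have hfin : ∫⁻ v, ‖h v‖ₑ ≠ ⊤ := (L1.integrable_coeFn h).2.ne
  have h1 : ∫⁻ v, ‖opL γ b h v‖ₑ ≤ ENNReal.ofReal (2 * K) * ∫⁻ v, ‖h v‖ₑ := by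
    calc ∫⁻ v, ‖opL γ b h v‖ₑ
        ≤ ∫⁻ v, (‖opL γ b h v + K * h v‖ₑ + ENNReal.ofReal K * ‖h v‖ₑ) := by
          refine lintegral_mono fun v => ?_
          have h2 : opL γ b h v = (opL γ b h v + K * h v) - K * h v := by ring
          calc ‖opL γ b h v‖ₑ = ‖(opL γ b h v + K * h v) - K * h v‖ₑ := by rw [← h2]
            _ ≤ ‖opL γ b h v + K * h v‖ₑ + ‖K * h v‖ₑ := enorm_sub_le
            _ = _ := by rw [enorm_mul, Real.enorm_of_nonneg hK0]
      _ = (∫⁻ v, ‖opL γ b h v + K * h v‖ₑ) + ENNReal.ofReal K * ∫⁻ v, ‖h v‖ₑ := by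
          rw [lintegral_add_right _ ((hmeas h).enorm.const_mul _),
            lintegral_const_mul _ (hmeas h).enorm]
      _ ≤ ENNReal.ofReal K * (∫⁻ v, ‖h v‖ₑ) + ENNReal.ofReal K * ∫⁻ v, ‖h v‖ₑ := by
          gcongr
          exact lintegral_enorm_opL_add_le hd hγ hγ0 hb hK0 hK (hmeas h) (L1.integrable_coeFn h)
      _ = _ := by
          rw [two_mul, ENNReal.ofReal_add hK0 hK0]
          ring
  have h2 : ‖T h‖ = (∫⁻ v, ‖opL γ b h v‖ₑ).toReal := by
    rw [L1.norm_def]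
    congr 1
    refine lintegral_congr_ae ?_
    filter_upwards [(hint h).coeFn_toL1] with v hv
    exact congrArg _ hv
  have h3 := ENNReal.toReal_mono (ENNReal.mul_ne_top ENNReal.ofReal_ne_top hfin) h1
  rw [h2]
  refine h3.trans_eq ?_
  rw [ENNReal.toReal_mul, ENNReal.toReal_ofReal (by positivity), L1.norm_def]

/-! ### Mild solutions as exponentials. -/

/-- Mild solutions of a linear equation with bounded generator `A - K`. -/
lemma eq_exp_of_mild {E : Type*} [NormedAddCommGroup E] [NormedSpace ℝ E] [CompleteSpace E]
    (A T : E →L[ℝ] E) (K : ℝ) (hT : ∀ x, T x = A x - K • x) (x₀ : E) (f : ℝ → E)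
    (hf : ContinuousOn f (Ici 0)) (hmild : ∀ t, 0 ≤ t → f t = x₀ + T (∫ τ in (0 : ℝ)..t, f τ))
    {t : ℝ} (ht : 0 ≤ t) :
    f t = Real.exp (-K * t) • (NormedSpace.exp (t • A) : E →L[ℝ] E) x₀ := by
  -- Constant extension to negative times gives a continuous function on the line, so its primitive
  -- is differentiable at `0` as well.
  set F : ℝ → E := fun t => f (max t 0) with hF
  have hFc : Continuous F := hf.comp_continuous (by fun_prop) fun t => le_max_right t 0
  have hFf : ∀ t, 0 ≤ t → F t = f t := fun t ht => by simp [hF, ht]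
  have hmildF : ∀ t, 0 ≤ t → f t = x₀ + T (∫ τ in (0 : ℝ)..t, F τ) := by
    intro t ht
    rw [hmild t ht]
    congr 2
    refine intervalIntegral.integral_congr fun τ hτ => ?_
    rw [uIcc_of_le ht] at hτ
    exact (hFf τ hτ.1).symm
  have hder : ∀ t, 0 ≤ t → HasDerivWithinAt f (T (f t)) (Ici t) t := by
    intro t ht
    have h1 : HasDerivAt (fun t => ∫ τ in (0 : ℝ)..t, F τ) (F t) t :=
      intervalIntegral.integral_hasDerivAt_right (hFc.intervalIntegrable _ _)
        (hFc.stronglyMeasurableAtFilter _ _) hFc.continuousAt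
    have h2 := (T.hasFDerivAt.comp_hasDerivAt t h1).const_add x₀
    rw [hFf t ht] at h2
    refine h2.hasDerivWithinAt.congr (fun r hr => hmildF r (ht.trans hr)) (hmildF t ht)
  have hexp : ∀ t : ℝ, HasDerivAt
      (fun t : ℝ => Real.exp (-K * t) • (NormedSpace.exp (t • A) : E →L[ℝ] E) x₀)
      (T (Real.exp (-K * t) • (NormedSpace.exp (t • A) : E →L[ℝ] E) x₀)) t := by
    intro t
    have h1 : HasDerivAt (fun t : ℝ => (NormedSpace.exp (t • A) : E →L[ℝ] E))
      (A * NormedSpace.exp (t • A)) t := hasDerivAt_exp_smul_const' A t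
    have h2 := h1.clm_apply (hasDerivAt_const t x₀)
    have h3 : HasDerivAt (fun t : ℝ => Real.exp (-K * t)) (Real.exp (-K * t) * (-K)) t := by
      simpa using ((hasDerivAt_id t).const_mul (-K)).exp
    have h4 := h3.smul h2
    refine h4.congr_deriv ?_
    rw [hT, map_smul]
    simp only [mul_apply_eq_comp, map_zero, add_zero]
    module
  have huniq := ODE_solution_unique_of_mem_Icc_right (a := 0) (b := t) (v := fun _ => T)
    (s := fun _ => univ) (K := ‖T‖₊) (f := f)
    (g := fun t : ℝ => Real.exp (-K * t) • (NormedSpace.exp (t • A) : E →L[ℝ] E) x₀)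
    (fun _ _ => T.lipschitz.lipschitzOnWith) (hf.mono Icc_subset_Ici_self)
    (fun r hr => hder r hr.1) (fun _ _ => mem_univ _)
    (fun r _ => (hexp r).continuousAt.continuousWithinAt)
    (fun r _ => (hexp r).hasDerivWithinAt) (fun _ _ => mem_univ _)
    (by simp [hmild 0 le_rfl])
  exact huniq (right_mem_Icc.2 ht)

/-! ### Weighted norms along the exponential series. -/

section Weighted

variable {α : Type*} [MeasurableSpace α] {μ : Measure α} {W : α → ENNReal}

/-- The weight may be unbounded, so `L¹` convergence controls the weighted norm only through Fatou's
lemma along an almost everywhere convergent subsequence. -/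
lemma lintegral_mul_enorm_le_of_tendsto (hW : Measurable W)
    (hWt : ∀ v, W v ≠ ⊤) {u : ℕ → (α →₁[μ] ℝ)} {x : α →₁[μ] ℝ}
    (hu : Filter.Tendsto u Filter.atTop (nhds x)) {R : ENNReal}
    (hR : ∀ n, ∫⁻ v, W v * ‖u n v‖ₑ ∂μ ≤ R) : ∫⁻ v, W v * ‖x v‖ₑ ∂μ ≤ R := by
  obtain ⟨φ, -, hφ⟩ := (tendstoInMeasure_of_tendsto_Lp hu).exists_seq_tendsto_ae
  have hm : ∀ y : α →₁[μ] ℝ, Measurable y := fun y => (Lp.stronglyMeasurable y).measurable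
  calc ∫⁻ v, W v * ‖x v‖ₑ ∂μ
      ≤ ∫⁻ v, Filter.liminf (fun n => W v * ‖u (φ n) v‖ₑ) Filter.atTop ∂μ := by
        refine lintegral_mono_ae ?_
        filter_upwards [hφ] with v hv
        rw [(ENNReal.Tendsto.const_mul hv.enorm (Or.inr (hWt v))).liminf_eq]
    _ ≤ Filter.liminf (fun n => ∫⁻ v, W v * ‖u (φ n) v‖ₑ ∂μ) Filter.atTop :=
        lintegral_liminf_le fun n => hW.fun_mul (hm _).enorm
    _ ≤ R := by
        refine Filter.liminf_le_of_le (by isBoundedDefault) fun b hb => ?_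
        obtain ⟨n, hn⟩ := hb.exists
        exact hn.trans (hR _)

lemma lintegral_mul_enorm_sum_le (hW : Measurable W) (u : ℕ → (α →₁[μ] ℝ)) (k : ℕ) :
    ∫⁻ v, W v * ‖(∑ n ∈ Finset.range k, u n : α →₁[μ] ℝ) v‖ₑ ∂μ ≤
      ∑ n ∈ Finset.range k, ∫⁻ v, W v * ‖u n v‖ₑ ∂μ := by
  have hm : ∀ y : α →₁[μ] ℝ, Measurable y := fun y => (Lp.stronglyMeasurable y).measurable
  induction k with
  | zero =>
    simp only [Finset.range_zero, Finset.sum_empty]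
    refine le_of_eq ?_
    rw [lintegral_eq_zero_iff (hW.fun_mul (hm _).enorm)]
    filter_upwards [Lp.coeFn_zero ℝ 1 μ] with v hv
    rw [hv]
    simp
  | succ k ih =>
    rw [Finset.sum_range_succ, Finset.sum_range_succ]
    calc ∫⁻ v, W v * ‖((∑ n ∈ Finset.range k, u n) + u k : α →₁[μ] ℝ) v‖ₑ ∂μ
        ≤ ∫⁻ v, (W v * ‖(∑ n ∈ Finset.range k, u n : α →₁[μ] ℝ) v‖ₑ + W v * ‖u k v‖ₑ) ∂μ := by
          refine lintegral_mono_ae ?_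
          filter_upwards [Lp.coeFn_add (∑ n ∈ Finset.range k, u n) (u k)] with v hv
          rw [hv, ← mul_add]
          exact mul_le_mul_right (enorm_add_le _ _) _
      _ = _ := lintegral_add_right _ (hW.fun_mul (hm _).enorm)
      _ ≤ _ := by gcongr

lemma lintegral_mul_enorm_smul (hW : Measurable W) (c : ℝ) (x : α →₁[μ] ℝ) :
    ∫⁻ v, W v * ‖(c • x : α →₁[μ] ℝ) v‖ₑ ∂μ = ‖c‖ₑ * ∫⁻ v, W v * ‖x v‖ₑ ∂μ := by
  have hm : ∀ y : α →₁[μ] ℝ, Measurable y := fun y => (Lp.stronglyMeasurable y).measurable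
  rw [← lintegral_const_mul _ (hW.fun_mul (hm _).enorm)]
  refine lintegral_congr_ae ?_
  filter_upwards [Lp.coeFn_smul c x] with v hv
  rw [hv, Pi.smul_apply, enorm_smul]
  ring

/-- The full series is the derivative of `e^(K t)` in `K`. In the term `n = 0` the factor `n`
cancels the truncated exponent `n - 1`. -/
lemma sum_pow_div_factorial_mul_le {K t : ℝ} (hK : 0 ≤ K) (ht : 0 ≤ t) (k : ℕ) :
    ∑ n ∈ Finset.range k, (n.factorial : ℝ)⁻¹ * t ^ n * (n * K ^ (n - 1)) ≤
      t * Real.exp (K * t) := by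
  cases k with
  | zero =>
    simp only [Finset.range_zero, Finset.sum_empty]
    positivity
  | succ k =>
    rw [Finset.sum_range_succ']
    simp only [Nat.cast_zero, zero_mul, mul_zero, add_zero, Nat.add_sub_cancel]
    calc ∑ n ∈ Finset.range k,
          ((n + 1).factorial : ℝ)⁻¹ * t ^ (n + 1) * (((n + 1 : ℕ) : ℝ) * K ^ n)
        = t * ∑ n ∈ Finset.range k, (K * t) ^ n / n.factorial := by
          rw [Finset.mul_sum]
          refine Finset.sum_congr rfl fun n _ => ?_
          rw [Nat.factorial_succ]
          push_cast
          field_simp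
          ring
      _ ≤ t * Real.exp (K * t) := by
          gcongr
          exact Real.sum_le_exp_of_nonneg (by positivity) k

/-- If `A` grows a weighted norm by a factor `K` up to a multiple of the `L¹` norm, then
`exp (-K t) exp (t A)` makes it grow at most linearly. -/
lemma lintegral_mul_enorm_exp_le (hW : Measurable W) (hWt : ∀ v, W v ≠ ⊤)
    (A : (α →₁[μ] ℝ) →L[ℝ] (α →₁[μ] ℝ)) {K C : ℝ}
    (hK : 0 ≤ K) (hC : 0 ≤ C)
    (hA₁ : ∀ h, ∫⁻ v, ‖A h v‖ₑ ∂μ ≤ ENNReal.ofReal K * ∫⁻ v, ‖h v‖ₑ ∂μ)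
    (hA : ∀ h, ∫⁻ v, W v * ‖A h v‖ₑ ∂μ ≤
      ENNReal.ofReal K * (∫⁻ v, W v * ‖h v‖ₑ ∂μ) + ENNReal.ofReal C * ∫⁻ v, ‖h v‖ₑ ∂μ)
    {x : α →₁[μ] ℝ} {N : ℝ} (hN : 0 ≤ N) (hx₁ : ∫⁻ v, ‖x v‖ₑ ∂μ ≤ 1)
    (hx : ∫⁻ v, W v * ‖x v‖ₑ ∂μ ≤ ENNReal.ofReal N) {t : ℝ} (ht : 0 ≤ t) :
    ∫⁻ v, W v * ‖(Real.exp (-K * t) • (NormedSpace.exp (t • A) :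
      (α →₁[μ] ℝ) →L[ℝ] (α →₁[μ] ℝ)) x : α →₁[μ] ℝ) v‖ₑ ∂μ ≤ ENNReal.ofReal (N + C * t) := by
  have hpow₁ : ∀ n : ℕ, ∫⁻ v, ‖(A ^ n) x v‖ₑ ∂μ ≤ ENNReal.ofReal (K ^ n) := by
    intro n
    induction n with
    | zero => simpa using hx₁
    | succ n ih =>
      rw [pow_succ', mul_apply_eq_comp, pow_succ', ENNReal.ofReal_mul hK]
      exact (hA₁ _).trans (mul_le_mul_right ih _)
  -- The source terms accumulate by `K · n K^(n-1) + K^n = (n + 1) K^n`.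
  have hpow : ∀ n : ℕ, ∫⁻ v, W v * ‖(A ^ n) x v‖ₑ ∂μ ≤
      ENNReal.ofReal (K ^ n * N + n * K ^ (n - 1) * C) := by
    intro n
    induction n with
    | zero => simpa using hx
    | succ n ih =>
      rw [pow_succ', mul_apply_eq_comp]
      calc _ ≤ ENNReal.ofReal K * ENNReal.ofReal (K ^ n * N + n * K ^ (n - 1) * C) +
            ENNReal.ofReal C * ENNReal.ofReal (K ^ n) :=
            (hA _).trans (add_le_add (mul_le_mul_right ih _) (mul_le_mul_right (hpow₁ n) _))
        _ = _ := by
          rw [← ENNReal.ofReal_mul hK, ← ENNReal.ofReal_mul hC,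
            ← ENNReal.ofReal_add (by positivity) (by positivity)]
          congr 1
          cases n with
          | zero => simp
          | succ n =>
            simp only [Nat.add_sub_cancel]
            push_cast
            ring
  have hsum := (ContinuousLinearMap.apply ℝ (α →₁[μ] ℝ) x).hasSum
    (NormedSpace.exp_series_hasSum_exp' (𝕂 := ℝ) (t • A))
  rw [lintegral_mul_enorm_smul hW]
  have hlim : ∫⁻ v, W v * ‖((NormedSpace.exp (t • A) :
      (α →₁[μ] ℝ) →L[ℝ] (α →₁[μ] ℝ)) x : α →₁[μ] ℝ) v‖ₑ ∂μ ≤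
      ENNReal.ofReal (Real.exp (K * t) * (N + C * t)) := by
    refine lintegral_mul_enorm_le_of_tendsto hW hWt hsum.tendsto_sum_nat fun k => ?_
    refine (lintegral_mul_enorm_sum_le hW _ k).trans ?_
    have hterm : ∀ n ∈ Finset.range k, ∫⁻ v, W v *
        ‖((ContinuousLinearMap.apply ℝ (α →₁[μ] ℝ) x)
          (((n.factorial : ℝ)⁻¹) • (t • A) ^ n) : α →₁[μ] ℝ) v‖ₑ ∂μ ≤
        ENNReal.ofReal ((n.factorial : ℝ)⁻¹ * t ^ n * (K ^ n * N + n * K ^ (n - 1) * C)) := by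
      intro n _
      rw [smul_pow, smul_smul, map_smul, lintegral_mul_enorm_smul hW,
        Real.enorm_of_nonneg (by positivity),
        ENNReal.ofReal_mul (p := (n.factorial : ℝ)⁻¹ * t ^ n) (by positivity)]
      exact mul_le_mul_right (hpow n) _
    refine (Finset.sum_le_sum hterm).trans ?_
    rw [← ENNReal.ofReal_sum_of_nonneg fun n _ => by positivity]
    refine ENNReal.ofReal_le_ofReal ?_
    have h1 := Real.sum_le_exp_of_nonneg (mul_nonneg hK ht) k
    have h2 := sum_pow_div_factorial_mul_le hK ht k
    calc ∑ n ∈ Finset.range k,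
          (n.factorial : ℝ)⁻¹ * t ^ n * (K ^ n * N + n * K ^ (n - 1) * C)
        = N * (∑ n ∈ Finset.range k, (K * t) ^ n / n.factorial) + C *
          ∑ n ∈ Finset.range k, (n.factorial : ℝ)⁻¹ * t ^ n * (n * K ^ (n - 1)) := by
          rw [Finset.mul_sum, Finset.mul_sum, ← Finset.sum_add_distrib]
          refine Finset.sum_congr rfl fun n _ => ?_
          rw [mul_pow, div_eq_mul_inv]
          ring
      _ ≤ N * Real.exp (K * t) + C * (t * Real.exp (K * t)) := by gcongr
      _ = _ := by ring
  refine (mul_le_mul_right hlim _).trans_eq ?_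
  rw [Real.enorm_of_nonneg (Real.exp_nonneg _), ← ENNReal.ofReal_mul (Real.exp_nonneg _),
    ← mul_assoc, ← Real.exp_add]
  simp

end Weighted

/-! ### Weighted initial data and conclusion. -/

lemma one_le_bracket (v : Vel d) : 1 ≤ bracket v := by
  rw [bracket, Real.one_le_sqrt]
  have : (0 : ℝ) ≤ ‖v‖ ^ 2 := by positivity
  linarith

lemma norm_le_bracket (v : Vel d) : ‖v‖ ≤ bracket v :=
  Real.le_sqrt_of_sq_le (by linarith)

lemma MemWeightedL1.integrable {s : ℝ} (hs : 0 ≤ s) {f : Vel d → ℝ} (hf : MemWeightedL1 s f) :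
    Integrable f := by
  refine hf.2.mono hf.1 (Filter.Eventually.of_forall fun v => ?_)
  have h1 : 1 ≤ bracket v ^ s := Real.one_le_rpow (one_le_bracket v) hs
  simp only [norm_mul, Real.norm_eq_abs, abs_abs]
  rw [abs_of_nonneg (zero_le_one.trans h1)]
  exact le_mul_of_one_le_left (abs_nonneg _) h1

lemma MemWeightedL1.lintegral_rpow_mul_enorm_le {s : ℝ} (hs : 0 ≤ s) {f : Vel d → ℝ}
    (hf : MemWeightedL1 s f) :
    ∫⁻ v, ENNReal.ofReal (‖v‖ ^ s) * ‖f v‖ₑ ≤ ENNReal.ofReal (weightedL1Norm s f) := by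
  have hb : ∀ v : Vel d, 0 ≤ bracket v := fun v => zero_le_one.trans (one_le_bracket v)
  rw [weightedL1Norm, ofReal_integral_eq_lintegral_ofReal hf.2
    (Filter.Eventually.of_forall fun v => mul_nonneg (Real.rpow_nonneg (hb v) s) (abs_nonneg _))]
  refine lintegral_mono fun v => ?_
  rw [ENNReal.ofReal_mul (Real.rpow_nonneg (hb v) s), Real.enorm_eq_ofReal_abs]
  gcongr
  exact norm_le_bracket v

end LinearBoltzmann

end

open LinearBoltzmann

/-- At most linear growth of the moments of solutions of the linear Boltzmann equation with
cut-off soft potentials. -/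
theorem theorem2p4 (d : ℕ) (γ : ℝ) (hγ : -(d : ℝ) < γ ∧ γ < 0) (b : ℝ → ℝ)
    (hb : LinearBoltzmann.IsBoundedAngularKernel d b)
    (s : ℝ) (hs : s = 2 ∨ 2 * max |γ| 1 < s) :
    ∃ C : ℝ → ℝ, ∀ f₀ : LinearBoltzmann.Vel d → ℝ,
      LinearBoltzmann.MemWeightedL1 s f₀ → (∀ᵐ v, 0 ≤ f₀ v) → (∫ v, f₀ v) = 1 →
      ∀ f : ℝ → (LinearBoltzmann.Vel d →₁[volume] ℝ),
        LinearBoltzmann.IsMildSolution γ b f₀ f →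
        ∀ t : ℝ, 0 ≤ t →
          Integrable (fun v => ‖v‖ ^ s * f t v) volume ∧
          LinearBoltzmann.moment s (f t) ≤
            C (LinearBoltzmann.weightedL1Norm s f₀) * (1 + t) := by
  obtain ⟨hγd, hγ0⟩ := hγ
  have hd : 0 < d := by
    rw [← Nat.cast_pos (α := ℝ)]
    linarith
  have hs2 : 2 ≤ s := by
    rcases hs with rfl | hs
    · exact le_rfl
    · linarith [le_max_right |γ| 1]
  have hs0 : 0 ≤ s := by linarith
  obtain ⟨K, hK0, hK⟩ := exists_collisionFrequency_le hd hγd hγ0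
  obtain ⟨M, hM, hgain⟩ := exists_lintegral_rpow_gain_le hd hγd hγ0 hb hs2
  obtain ⟨T, hT⟩ := exists_opL_continuousLinearMap hd hγd hγ0 hb
  -- The bound obtained is `N + M t`, which is at most `(N + M) (1 + t)`.
  refine ⟨fun N => N + M, fun f₀ hf₀ hpos hmass f hf t ht => ?_⟩
  have hi₀ := hf₀.integrable hs0
  set N := weightedL1Norm s f₀ with hN
  have hN0 : 0 ≤ N := integral_nonneg fun v => by
    have := one_le_bracket v
    positivity
  set x := hi₀.toL1 f₀ with hx
  have hxf : x =ᵐ[volume] f₀ := hi₀.coeFn_toL1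
  set W : Vel d → ENNReal := fun v => ENNReal.ofReal (‖v‖ ^ s) with hW
  have hWm : Measurable W := by fun_prop
  let A : (Vel d →₁[volume] ℝ) →L[ℝ] (Vel d →₁[volume] ℝ) := T + K • ContinuousLinearMap.id ℝ _
  have hA : ∀ h, A h =ᵐ[volume] fun v => opL γ b h v + K * h v := by
    intro h
    filter_upwards [Lp.coeFn_add (T h) (K • h), Lp.coeFn_smul K h, hT h] with v h1 h2 h3
    change (T h + K • h : Vel d →₁[volume] ℝ) v = _
    rw [h1, Pi.add_apply, h2, h3]
    rfl
  have hm : ∀ h : Vel d →₁[volume] ℝ, Measurable h := fun h => (Lp.stronglyMeasurable h).measurable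
  have hsol : f t = Real.exp (-K * t) • (NormedSpace.exp (t • A) :
      (Vel d →₁[volume] ℝ) →L[ℝ] (Vel d →₁[volume] ℝ)) x := by
    -- The almost everywhere mild equation becomes an identity in `L¹`, with `T = A - K`.
    refine eq_exp_of_mild A T K (fun h => by simp [A]) x f hf.continuousOn (fun r hr => ?_) ht
    refine Lp.ext ?_
    filter_upwards [hf.mild r hr, hT (∫ τ in (0 : ℝ)..r, f τ), hxf,
      Lp.coeFn_add x (T (∫ τ in (0 : ℝ)..r, f τ))] with v h1 h2 h3 h4
    rw [h4, Pi.add_apply, h1, h2, h3]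
  have hx₁ : ∫⁻ v, ‖x v‖ₑ ≤ 1 := by
    have h₁ := ofReal_integral_eq_lintegral_ofReal hi₀ hpos
    rw [hmass, ENNReal.ofReal_one] at h₁
    refine ((lintegral_congr_ae ?_).trans h₁.symm).le
    filter_upwards [hxf, hpos] with v h1 h2
    rw [h1, Real.enorm_of_nonneg h2]
  have hxW : ∫⁻ v, W v * ‖x v‖ₑ ≤ ENNReal.ofReal N := by
    refine le_trans (lintegral_congr_ae ?_).le (hf₀.lintegral_rpow_mul_enorm_le hs0)
    filter_upwards [hxf] with v h1
    rw [h1]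
  have hbound : ∫⁻ v, W v * ‖f t v‖ₑ ≤ ENNReal.ofReal (N + M * t) := by
    rw [hsol]
    refine lintegral_mul_enorm_exp_le hWm (fun v => ENNReal.ofReal_ne_top) A hK0 hM
      (fun h => ?_) (fun h => ?_) hN0 hx₁ hxW ht
    · refine le_trans (lintegral_congr_ae ?_).le
        (lintegral_enorm_opL_add_le hd hγd hγ0 hb hK0 hK (hm h) (L1.integrable_coeFn h))
      filter_upwards [hA h] with v hv
      rw [hv]
    · refine le_trans (lintegral_congr_ae ?_).le
        (lintegral_mul_enorm_opL_add_le hd hγd hγ0 hb hK0 hK hWm hgain (hm h)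
          (L1.integrable_coeFn h))
      filter_upwards [hA h] with v hv
      rw [hv]
  have henorm : ∀ v, ‖‖v‖ ^ s * f t v‖ₑ = W v * ‖f t v‖ₑ := by
    intro v
    rw [enorm_mul, Real.enorm_of_nonneg (by positivity)]
  have hnn : 0 ≤ N + M * t := by positivity
  refine ⟨⟨?_, ?_⟩, ?_⟩
  · have hft := hm (f t)
    exact (by fun_prop : Measurable fun v : Vel d => ‖v‖ ^ s * f t v).aestronglyMeasurable
  · rw [HasFiniteIntegral]
    simp only [henorm]
    exact hbound.trans_lt ENNReal.ofReal_lt_top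
  · have h1 : ‖moment s (f t)‖ₑ ≤ ENNReal.ofReal (N + M * t) := by
      refine (enorm_integral_le_lintegral_enorm _).trans ?_
      simp only [henorm]
      exact hbound
    have h2 : moment s (f t) ≤ N + M * t := by
      rw [Real.enorm_eq_ofReal_abs, ENNReal.ofReal_le_ofReal_iff hnn] at h1
      exact (le_abs_self _).trans h1
    nlinarith [mul_nonneg hN0 ht]
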